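/- Let $G_{\mathcal L}$ be the multigraph of the lips tangle $\mathcal L$: it has three vertices $a,b,c$ (the singular points of $\mathcal L$) and five edges, namely two edges joining $a$ and $b$, two edges joining $b$ and $c$, and one edge joining $a$ and $c$. The topological class $\mathcal G(\mathcal L)$ is the collection of all multigraphs that are (isomorphic to) subdivisions of $G_{\mathcal L}$, i.e. that are obtained from it by inserting zero or more (finitely many) new vertices of degree $2$ along its edges. For multigraphs write $K\succeq H$ if $K$ is isomorphic to a subdivision of $H$. Eventually all (almost all) members of $\mathcal G(\mathcal L)$ have a property $P$ if there is an $H\in\mathcal G(\mathcal L)$ such that every $K\in\mathcal G(\mathcal L)$ with $K\succeq H$ has property $P$. A set of vertices is contiguous if it is empty or induces a connected subgraph. A monotone valuation on the vertex set $V$ is a function $\nu$ from the subsets of $V$ to $\mathbb R$ with $\nu(\emptyset)=0$ and $\nu(X)\le\nu(Y)$ whenever $X\subseteq Y$. **Theorem.** (1) Every $G\in\mathcal G(\mathcal L)$ guarantees contiguous EF1$_{\text{outer}}$ allocations for three agents with monotone valuations: for any three monotone valuations $\nu_1,\nu_2,\nu_3$ on $V(G)$ there is a partition of $V(G)$ into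 three (possibly empty) contiguous shares $A_1,A_2,A_3$ such that for all $i\ne j$ there is a set $X\subseteq A_j$ with $|X|\le 1$ for which $A_j\setminus X$ is contiguous and $\nu_i(A_i)\ge\nu_i(A_j\setminus X)$. (2) Eventually all members of $\mathcal G(\mathcal L)$ are simple graphs (no loops or parallel edges) that are non-Hamiltonian, in the sense that no path visits every vertex exactly once. -/

import Mathlib

/-! ### Fair division of the vertices of a graph -/

section FairDivision

variable {V ι : Type*}

/-- A set of vertices is contiguous if it induces a connected subgraph. The empty share, which may
be awarded and may be left over after a removal, counts as contiguous. -/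
def Contiguous (G : SimpleGraph V) (S : Set V) : Prop :=
  (G.induce S).Preconnected

/-- A monotone valuation of sets of indivisible objects (nonnegativity follows). -/
structure IsMonotoneValuation (ν : Set V → ℝ) : Prop where
  empty : ν ∅ = 0
  mono : ∀ ⦃X Y : Set V⦄, X ⊆ Y → ν X ≤ ν Y

/-- An allocation: the shares `A i` partition the set of all objects among the agents. -/
structure IsAllocation (A : ι → Set V) : Prop where
  disjoint : ∀ i j, i ≠ j → Disjoint (A i) (A j)
  cover : ⋃ i, A i = Set.univ

/-- Envy-freeness up to `k` outer goods: for `i ≠ j` there is a selection `X` of at most `k`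
objects of the share of `j` whose removal leaves that share contiguous and erases the envy
that `i` may feel for it. -/
def IsEFOuter (G : SimpleGraph V) (k : ℕ) (ν : ι → Set V → ℝ) (A : ι → Set V) : Prop :=
  ∀ i j, i ≠ j → ∃ X : Finset V, X.card ≤ k ∧ (X : Set V) ⊆ A j ∧
    Contiguous G (A j \ X) ∧ ν i (A j \ X) ≤ ν i (A i)

/-- `G` guarantees contiguous allocations that are envy-free up to `k` outer goods for `n` agents
with (arbitrary) monotone valuations. -/
def GuaranteesEFOuter (G : SimpleGraph V) (k n : ℕ) : Prop :=
  ∀ ν : Fin n → Set V → ℝ, (∀ i, IsMonotoneValuation (ν i)) →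
    ∃ A : Fin n → Set V, IsAllocation A ∧ (∀ i, Contiguous G (A i)) ∧ IsEFOuter G k ν A

open Classical in
/-- Hamiltonian in the sense of traceable: some path visits every vertex exactly once. -/
def HasHamiltonianPath (G : SimpleGraph V) : Prop :=
  ∃ (u v : V) (p : G.Walk u v), p.IsHamiltonian

end FairDivision

universe u

/-! ### Multigraphs, subdivisions and topological classes -/

/-- A multigraph (loops and parallel edges allowed) together with its ambient types. -/
structure Multigraph : Type (u + 1) where
  /-- ambient type of the vertices -/
  V : Type u
  /-- ambient type of the edges -/
  E : Type u
  /-- the multigraph -/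
  graph : Graph V E

/-- The data of a subdivision `H` of `G` (up to isomorphism): each edge `e` of `G`, traversed from
its end `s e` to its end `t e`, is replaced by a path with `n e` new inner vertices. -/
structure Subdivision {α β α' β' : Type*} (G : Graph α β) (H : Graph α' β') where
  /-- the first end of an edge of `G` -/
  s : G.edgeSet → G.vertexSet
  /-- the second end of an edge of `G` -/
  t : G.edgeSet → G.vertexSet
  isLink_ends : ∀ e : G.edgeSet, G.IsLink e (s e) (t e)
  /-- the number of vertices inserted along an edge of `G` -/
  n : G.edgeSet → ℕ
  /-- the vertices of `H` are those of `G` and the subdivision vertices -/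
  vertexEquiv : G.vertexSet ⊕ (Σ e : G.edgeSet, Fin (n e)) ≃ H.vertexSet
  /-- each edge `e` of `G` gives rise to `n e + 1` edges of `H` -/
  edgeEquiv : (Σ e : G.edgeSet, Fin (n e + 1)) ≃ H.edgeSet
  /-- the `i`-th edge along `e` leads from the `i`-th vertex along `e` to the next one; the
  vertices along `e` are `s e`, the `n e` subdivision vertices, and `t e`, in this order -/
  isLink : ∀ (e : G.edgeSet) (i : Fin (n e + 1)), H.IsLink (edgeEquiv ⟨e, i⟩)
    (vertexEquiv ((Fin.cons (Sum.inl (s e)) fun j => Sum.inr ⟨e, j⟩ :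
      Fin (n e + 1) → G.vertexSet ⊕ (Σ e : G.edgeSet, Fin (n e))) i))
    (vertexEquiv ((Fin.snoc (fun j => Sum.inr ⟨e, j⟩) (Sum.inl (t e)) :
      Fin (n e + 1) → G.vertexSet ⊕ (Σ e : G.edgeSet, Fin (n e))) i))

/-- `H` is isomorphic to a subdivision of `G`. -/
def IsSubdivisionOf {α β α' β' : Type*} (H : Graph α' β') (G : Graph α β) : Prop :=
  Nonempty (Subdivision G H)

/-- The class of all subdivisions of a multigraph `T`. For `T` the multigraph of singular points
and edges of a tangle, this is the topological class of that tangle. -/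
def topologicalClass {α β : Type*} (T : Graph α β) : Set Multigraph.{u} :=
  {H | IsSubdivisionOf H.graph T}

/-- The final segment of the topological class generated by `H`, in the subdivision order. -/
def finalSegment {α β : Type*} (T : Graph α β) (H : Multigraph.{u}) : Set Multigraph.{u} :=
  {K | K ∈ topologicalClass T ∧ IsSubdivisionOf K.graph H.graph}

/-- Eventually all members of the topological class of `T` are `P`: the members with
property `P` include a final segment. -/
def EventuallyAll {α β : Type*} (T : Graph α β) (P : Multigraph.{u} → Prop) : Prop :=
  ∃ H ∈ topologicalClass.{u} T, ∀ K ∈ finalSegment T H, P K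

/-! ### The lips -/

/-- The singular points of the lips tangle. -/
inductive LipsVertex
  | a
  | b
  | c

/-- The edges of the lips tangle. -/
inductive LipsEdge
  | topLeft
  | midLeft
  | topRight
  | midRight
  | lower

/-- The two ends of each edge of the lips tangle. -/
def lipsEnds : LipsEdge → Sym2 LipsVertex
  | .topLeft => s(.a, .b)
  | .midLeft => s(.a, .b)
  | .topRight => s(.b, .c)
  | .midRight => s(.b, .c)
  | .lower => s(.a, .c)

/-- The multigraph of the lips tangle: its vertices are the three singular points, its edges
the five tangle edges. -/
def lips : Graph LipsVertex LipsEdge where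
  vertexSet := Set.univ
  edgeSet := Set.univ
  IsLink e x y := lipsEnds e = s(x, y)
  isLink_symm := fun _ _ => ⟨fun _ _ h => h.trans Sym2.eq_swap⟩
  eq_or_eq_of_isLink_of_isLink := by
    intro e x y v w h h'
    have := h.symm.trans h'
    rw [Sym2.eq_iff] at this
    tauto
  edge_mem_iff_exists_isLink := by
    intro e
    refine ⟨fun _ => ?_, fun _ => Set.mem_univ _⟩
    induction h : lipsEnds e with
    | _ x y => exact ⟨x, y, rfl⟩
  left_mem_of_isLink := fun _ _ _ _ => Set.mem_univ _

/-! Part (1) is a discrete winding number argument, by contradiction. At each triple of worths (a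
node) every agent names a favourite share. Along a sequence of nodes, the favourites of agents 0 and
1, read alternately, form a walk on the triangle with corners 0, 1, 2, and `jump` counts its signed
passages through the side joining 1 and 2. A node need not be an allocation: objects may be
unassigned and worths may be virtual, as long as each worth is a proxy, up to one outer object, for
a share of a contiguous allocation. If the three agents had distinct favourites at nodes near one
allocation, handing these out would be EF1 (`not_rainbow`). Without such an allocation, jumps near
it are differences of a potential (`exists_potential`), so they cancel around closed circuits.
Gluing four such regions gives the octagon identities, the elementary homotopies.

Fix the first share `L` and order the other vertices so that initial and final segments are
connected (`IsSweep`). Passing them one by one from the third share to the second yields the total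
jump `wind`. By the octagons it is invariant under swaps of neighbouring entries (`wind_swap`) and
under absorption of an end entry into `L` (`wind_eat_first`, `wind_eat_last`), provided that sweeps
result. For empty `L` it is -1, since the favourite moves from the third share to the second; for an
empty list it is 0. So no graph that `L` can devour by such moves is a counterexample.

For the lips, `L` absorbs the top left and lower paths, then the middle left path starting from its
end at `a`. A cycle through `b` and `c` remains. It cannot always be absorbed in its present order,
but swaps reverse the stretch formed by `c` and the top right path. Then `b` is absorbed, and what
remains is a path listed in order, starting next to `b`.

For part (2), bisect every edge. Further subdivisions stay simple, and deleting `a`, `b`, `c` leaves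
five components, whereas a path loses three vertices by falling into at most four pieces. -/

/-! ### Preferences over partially allocated shares -/

section Winding

variable {V : Type*}

/-- A rule that assigns a (virtual) worth to a share, for each valuation. -/
abbrev Worth (V : Type*) := (Set V → ℝ) → ℝ

/-- The worth of a set of objects. -/
def worth (S : Set V) : Worth V := fun ν => ν S

/-- The worth `f` is a valid proxy for the share `A` of an allocation: it is at most the value of
`A`, and at least the value of `A` less some outer object. -/
def IsProxy (G : SimpleGraph V) (f : Worth V) (A : Set V) : Prop :=
  ∀ ν, IsMonotoneValuation ν → f ν ≤ ν A ∧
    ∃ X : Finset V, X.card ≤ 1 ∧ (X : Set V) ⊆ A ∧ Contiguous G (A \ X) ∧ ν (A \ X) ≤ f ν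

theorem isProxy_self {G : SimpleGraph V} {A : Set V} (hA : Contiguous G A) :
    IsProxy G (worth A) A :=
  fun _ _ => ⟨le_rfl, ∅, by simp, by simp, by simpa using hA, by simp [worth]⟩

theorem isProxy_insert {G : SimpleGraph V} {A : Set V} {x : V} (hA : Contiguous G A)
    (hx : x ∉ A) : IsProxy G (worth A) (insert x A) := by
  have h : insert x A \ {x} = A := by simpa using hx
  exact fun ν hν => ⟨hν.mono (Set.subset_insert _ _), {x}, by simp, by simp, by simpa [h] using hA,
    by simp [worth, h]⟩

/-- The minimum still dominates the value of `A`, so removing `x` is enough. -/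
theorem isProxy_inf_left {G : SimpleGraph V} {A : Set V} {x y : V} (hA : Contiguous G A)
    (hx : x ∉ A) : IsProxy G (worth (insert x A) ⊓ worth (insert y A)) (insert x A) := by
  intro ν hν
  obtain ⟨-, X, hX⟩ := isProxy_insert hA hx ν hν
  refine ⟨inf_le_left, X, hX.1, hX.2.1, hX.2.2.1, hX.2.2.2.trans (le_inf ?_ ?_)⟩ <;>
    exact hν.mono (Set.subset_insert _ _)

theorem isProxy_inf_right {G : SimpleGraph V} {A : Set V} {x y : V} (hA : Contiguous G A)
    (hy : y ∉ A) : IsProxy G (worth (insert x A) ⊓ worth (insert y A)) (insert y A) := by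
  rw [inf_comm]
  exact isProxy_inf_left hA hy

/-- The object to remove depends on the valuation: dropping `x` or `y` leaves the less valuable of
the two sets. The worth of `A` alone would not do, as it lacks two objects. -/
theorem isProxy_inf_insert {G : SimpleGraph V} {A : Set V} {x y : V}
    (hxA : Contiguous G (insert x A)) (hyA : Contiguous G (insert y A))
    (hx : x ∉ insert y A) (hy : y ∉ insert x A) :
    IsProxy G (worth (insert x A) ⊓ worth (insert y A)) (insert x (insert y A)) := by
  intro ν hν
  have h1 := isProxy_insert hyA hx ν hν
  have h2 := isProxy_insert hxA hy ν hν
  rw [Set.insert_comm] at h2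
  refine ⟨inf_le_right.trans h1.1, ?_⟩
  rcases le_total (ν (insert x A)) (ν (insert y A)) with h | h
  · obtain ⟨X, hX⟩ := h2.2
    exact ⟨X, hX.1, hX.2.1, hX.2.2.1, hX.2.2.2.trans (le_inf le_rfl h)⟩
  · obtain ⟨X, hX⟩ := h1.2
    exact ⟨X, hX.1, hX.2.1, hX.2.2.1, hX.2.2.2.trans (le_inf h le_rfl)⟩

/-- The most preferred of three shares for the valuation `ν`. -/
noncomputable def label (ν : Set V → ℝ) (n : Fin 3 → Worth V) : Fin 3 :=
  Classical.choose (Finite.exists_max fun p => n p ν)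

theorem le_label (ν : Set V → ℝ) (n : Fin 3 → Worth V) (p : Fin 3) :
    n p ν ≤ n (label ν n) ν :=
  Classical.choose_spec (Finite.exists_max fun p => n p ν) p

/-- The three worths of `n` are proxies for the three shares of `α`. -/
def IsNear (G : SimpleGraph V) (n : Fin 3 → Worth V) (α : Fin 3 → Set V) : Prop :=
  ∀ p, IsProxy G (n p) (α p)

theorem isNear_vec {G : SimpleGraph V} {f₀ f₁ f₂ : Worth V} {A₀ A₁ A₂ : Set V}
    (h₀ : IsProxy G f₀ A₀) (h₁ : IsProxy G f₁ A₁) (h₂ : IsProxy G f₂ A₂) :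
    IsNear G ![f₀, f₁, f₂] ![A₀, A₁, A₂] := by
  intro p
  fin_cases p <;> assumption

/-- The three sets partition the vertices. -/
def IsTripartition (A B C : Set V) : Prop :=
  ∀ z, (z ∈ A ∧ z ∉ B ∧ z ∉ C) ∨ (z ∉ A ∧ z ∈ B ∧ z ∉ C) ∨ (z ∉ A ∧ z ∉ B ∧ z ∈ C)

theorem IsTripartition.isAllocation {A B C : Set V} (h : IsTripartition A B C) :
    IsAllocation ![A, B, C] := by
  refine ⟨fun i j hij => ?_, ?_⟩
  · rw [Set.disjoint_left]
    intro z
    have := h z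
    fin_cases i <;> fin_cases j <;> simp at hij ⊢ <;> tauto
  · ext z
    have := h z
    simp [Fin.exists_fin_succ]
    tauto

/-- No contiguous allocation is envy-free up to one outer good. -/
def NoEFOuter (G : SimpleGraph V) (ν : Fin 3 → Set V → ℝ) : Prop :=
  ¬ ∃ A : Fin 3 → Set V, IsAllocation A ∧ (∀ i, Contiguous G (A i)) ∧ IsEFOuter G 1 ν A

/-! ### Crossings and their local potential -/

/-- The signed crossing between the second and the third share. -/
def crossing (p q : Fin 3) : ℤ :=
  if p = 1 ∧ q = 2 then 1 else if p = 2 ∧ q = 1 then -1 else 0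

/-- A closed walk through `r`, `p`, `q` winds around the triangle only if it visits all three
corners. -/
theorem crossing_eq_sub : ∀ p q r : Fin 3, ¬ (p ≠ q ∧ p ≠ r ∧ q ≠ r) →
    crossing p q = crossing r q - crossing r p := by
  decide

/-- The signed crossing of the preferences of the first two agents between two nodes. -/
noncomputable def jump (ν : Fin 3 → Set V → ℝ) (n n' : Fin 3 → Worth V) : ℤ :=
  crossing (label (ν 0) n) (label (ν 1) n) + crossing (label (ν 1) n) (label (ν 0) n')

theorem isEFOuter_of_labels {G : SimpleGraph V} {ν : Fin 3 → Set V → ℝ}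
    (hν : ∀ i, IsMonotoneValuation (ν i)) {α : Fin 3 → Set V} (n : Fin 3 → Fin 3 → Worth V)
    (hn : ∀ i, IsNear G (n i) α) : IsEFOuter G 1 ν fun i => α (label (ν i) (n i)) := by
  intro i j _
  obtain ⟨-, X, h1, h2, h3, h4⟩ := hn i (label (ν j) (n j)) (ν i) (hν i)
  exact ⟨X, h1, h2, h3, h4.trans ((le_label _ _ _).trans (hn i (label (ν i) (n i)) (ν i) (hν i)).1)⟩

theorem not_rainbow {G : SimpleGraph V} {ν : Fin 3 → Set V → ℝ}
    (hν : ∀ i, IsMonotoneValuation (ν i)) (hno : NoEFOuter G ν) {α : Fin 3 → Set V}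
    (hα : IsAllocation α) (hc : ∀ i, Contiguous G (α i)) {n₀ n₁ n₂ : Fin 3 → Worth V}
    (h₀ : IsNear G n₀ α) (h₁ : IsNear G n₁ α) (h₂ : IsNear G n₂ α) :
    ¬ (label (ν 0) n₀ ≠ label (ν 1) n₁ ∧ label (ν 0) n₀ ≠ label (ν 2) n₂ ∧
      label (ν 1) n₁ ≠ label (ν 2) n₂) := by
  rintro ⟨h01, h02, h12⟩
  let n : Fin 3 → Fin 3 → Worth V := ![n₀, n₁, n₂]
  have hinj : Function.Injective fun i => label (ν i) (n i) := by
    intro i j hij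
    fin_cases i <;> fin_cases j <;> simp_all [n, eq_comm]
  have hsurj := Finite.surjective_of_injective hinj
  refine hno ⟨fun i => α (label (ν i) (n i)), ⟨fun i j hij => hα.disjoint _ _ (hinj.ne hij), ?_⟩,
    fun i => hc _, isEFOuter_of_labels hν n fun i => ?_⟩
  · rw [← hα.cover]
    exact hsurj.iUnion_comp α
  · fin_cases i <;> assumption

/-- Around a contiguous allocation, the jumps are the differences of a potential. -/
theorem exists_potential {G : SimpleGraph V} {ν : Fin 3 → Set V → ℝ}
    (hν : ∀ i, IsMonotoneValuation (ν i)) (hno : NoEFOuter G ν) {A B C : Set V}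
    (h : IsTripartition A B C) (hA : Contiguous G A) (hB : Contiguous G B)
    (hC : Contiguous G C) :
    ∃ φ : (Fin 3 → Worth V) → ℤ, ∀ n n', IsNear G n ![A, B, C] → IsNear G n' ![A, B, C] →
      jump ν n n' = φ n' - φ n := by
  have hc : ∀ i, Contiguous G (![A, B, C] i) := by
    intro i
    fin_cases i <;> assumption
  have hs := isNear_vec (isProxy_self hA) (isProxy_self hB) (isProxy_self hC)
  refine ⟨fun n => crossing (label (ν 2) ![worth A, worth B, worth C]) (label (ν 0) n),
    fun n n' hn hn' => ?_⟩
  have h1 := crossing_eq_sub _ _ _ (not_rainbow hν hno h.isAllocation hc hn hn hs)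
  have h2 := crossing_eq_sub _ _ _ (fun hr => not_rainbow hν hno h.isAllocation hc hn' hn hs
    ⟨hr.1.symm, hr.2.2, hr.2.1⟩)
  rw [jump, h1, h2]
  ring

/-- The node given by three sets. -/
def node (A B C : Set V) : Fin 3 → Worth V := ![worth A, worth B, worth C]

theorem label_node_nonempty {ν : Set V → ℝ} (hν : IsMonotoneValuation ν)
    (hpos : ∀ S : Set V, S.Nonempty → 0 < ν S) {A B C : Set V} (hne : (A ∪ B ∪ C).Nonempty) :
    (![A, B, C] (label ν (node A B C))).Nonempty := by
  rw [Set.nonempty_iff_ne_empty]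
  intro h
  have key : ∀ p, ν (![A, B, C] p) ≤ 0 := by
    intro p
    have hle := le_label ν (node A B C) p
    have hw : ∀ p, node A B C p ν = ν (![A, B, C] p) := by
      intro p
      fin_cases p <;> rfl
    rwa [hw, hw, h, hν.empty] at hle
  obtain ⟨z, (hz | hz) | hz⟩ := hne
  · exact (hpos A ⟨z, hz⟩).not_ge (key 0)
  · exact (hpos B ⟨z, hz⟩).not_ge (key 1)
  · exact (hpos C ⟨z, hz⟩).not_ge (key 2)

/-- This is not formal: the walk from `n` to `n'` passes the favourite of agent 1 at `n`, the walk
back the one at `n'`. -/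
theorem jump_antisymm {G : SimpleGraph V} {ν : Fin 3 → Set V → ℝ}
    (hν : ∀ i, IsMonotoneValuation (ν i)) (hno : NoEFOuter G ν) {A B C : Set V}
    (h : IsTripartition A B C) (hA : Contiguous G A) (hB : Contiguous G B)
    (hC : Contiguous G C) {n n' : Fin 3 → Worth V} (hn : IsNear G n ![A, B, C])
    (hn' : IsNear G n' ![A, B, C]) : jump ν n n' + jump ν n' n = 0 := by
  obtain ⟨φ, hφ⟩ := exists_potential hν hno h hA hB hC
  rw [hφ _ _ hn hn', hφ _ _ hn' hn]
  ring

/-! ### Octagon identities -/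

/-- Moving `x` from the second to the first share and `y` from the third to the second one. -/
theorem jump_octagon_first {G : SimpleGraph V} {ν : Fin 3 → Set V → ℝ}
    (hν : ∀ i, IsMonotoneValuation (ν i)) (hno : NoEFOuter G ν) {L M R : Set V} {x y : V}
    (h : IsTripartition (insert x L) (insert y M) R) (hxL : x ∉ L) (hyM : y ∉ M)
    (cL : Contiguous G L) (cLx : Contiguous G (insert x L)) (cM : Contiguous G M)
    (cMx : Contiguous G (insert x M)) (cMy : Contiguous G (insert y M))
    (cMxy : Contiguous G (insert x (insert y M))) (cR : Contiguous G R)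
    (cRy : Contiguous G (insert y R)) :
    jump ν (node L (insert x M) (insert y R)) (node L (insert x M) R) +
      jump ν (node L (insert x M) R) (node L (insert x (insert y M)) R) +
      (jump ν (node L (insert x (insert y M)) R) (node L (insert y M) R) +
      jump ν (node L (insert y M) R) (node (insert x L) (insert y M) R)) =
    jump ν (node L (insert x M) (insert y R)) (node L M (insert y R)) +
      jump ν (node L M (insert y R)) (node (insert x L) M (insert y R)) +
      (jump ν (node (insert x L) M (insert y R)) (node (insert x L) M R) +
      jump ν (node (insert x L) M R) (node (insert x L) (insert y M) R)) := by
  have hxM : x ∉ insert y M := by have := h x; simp_all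
  have hyR : y ∉ R := by have := h y; simp_all
  have hyx : y ∉ insert x M := by simp_all [eq_comm]
  have hxM' : x ∉ M := by simp_all
  have t1 : IsTripartition L (insert x M) (insert y R) := by
    intro z; have := h z; have := h x; have := h y; grind
  have t2 : IsTripartition L (insert x (insert y M)) R := by
    intro z; have := h z; have := h x; have := h y; grind
  have t3 : IsTripartition (insert x L) M (insert y R) := by
    intro z; have := h z; have := h x; have := h y; grind
  obtain ⟨φ₁, h1⟩ := exists_potential hν hno t1 cL cMx cRy
  obtain ⟨φ₂, h2⟩ := exists_potential hν hno t2 cL cMxy cR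
  obtain ⟨φ₃, h3⟩ := exists_potential hν hno t3 cLx cM cRy
  obtain ⟨φ₄, h4⟩ := exists_potential hν hno h cLx cMy cR
  -- The octagon is cut into four regions, one for each allocation, with inner corners `node L M R`
  -- and `c`. The former is not near the second allocation, whose middle share has two more objects
  -- than `M`; the minimum is a proxy for all three enlargements of `M`.
  let c : Fin 3 → Worth V := ![worth L, worth (insert x M) ⊓ worth (insert y M), worth R]
  have pL := isProxy_self cL
  have pLx := isProxy_self cLx
  have pL' := isProxy_insert cL hxL
  have pM := isProxy_self cM
  have pMx := isProxy_self cMx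
  have pMy := isProxy_self cMy
  have pMxy := isProxy_self cMxy
  have pR := isProxy_self cR
  have pRy := isProxy_self cRy
  have pR' := isProxy_insert cR hyR
  have qMx := isProxy_insert cM hxM'
  have qMy := isProxy_insert cM hyM
  have qMxy := isProxy_insert cMy hxM
  have qMyx := isProxy_insert cMx hyx
  rw [Set.insert_comm] at qMyx
  have v1 := isProxy_inf_left (y := y) cM hxM'
  have v2 := isProxy_inf_right (x := x) cM hyM
  have v3 := isProxy_inf_insert cMx cMy hxM hyx
  have aa := h1 _ (node L (insert x M) R) (isNear_vec pL pMx pRy) (isNear_vec pL pMx pR')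
  have ab := h1 _ (node L M (insert y R)) (isNear_vec pL pMx pRy) (isNear_vec pL qMx pRy)
  have ac := h1 (node L (insert x M) R) c (isNear_vec pL pMx pR') (isNear_vec pL v1 pR')
  have ad := h1 (node L M (insert y R)) (node L M R) (isNear_vec pL qMx pRy) (isNear_vec pL qMx pR')
  have ae := h1 (node L M R) c (isNear_vec pL qMx pR') (isNear_vec pL v1 pR')
  have ba := h2 (node L (insert x M) R) _ (isNear_vec pL qMyx pR) (isNear_vec pL pMxy pR)
  have bb := h2 _ (node L (insert y M) R) (isNear_vec pL pMxy pR) (isNear_vec pL qMxy pR)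
  have bc := h2 (node L (insert x M) R) c (isNear_vec pL qMyx pR) (isNear_vec pL v3 pR)
  have bd := h2 (node L (insert y M) R) c (isNear_vec pL qMxy pR) (isNear_vec pL v3 pR)
  have ca := h3 (node L M (insert y R)) _ (isNear_vec pL' pM pRy) (isNear_vec pLx pM pRy)
  have cb := h3 _ (node (insert x L) M R) (isNear_vec pLx pM pRy) (isNear_vec pLx pM pR')
  have cc := h3 (node L M (insert y R)) (node L M R) (isNear_vec pL' pM pRy) (isNear_vec pL' pM pR')
  have cd := h3 (node (insert x L) M R) (node L M R) (isNear_vec pLx pM pR') (isNear_vec pL' pM pR')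
  have da := h4 (node L (insert y M) R) _ (isNear_vec pL' pMy pR) (isNear_vec pLx pMy pR)
  have db := h4 (node (insert x L) M R) _ (isNear_vec pLx qMy pR) (isNear_vec pLx pMy pR)
  have dc := h4 (node L (insert y M) R) c (isNear_vec pL' pMy pR) (isNear_vec pL' v2 pR)
  have dd := h4 (node (insert x L) M R) (node L M R) (isNear_vec pLx qMy pR) (isNear_vec pL' qMy pR)
  have de := h4 (node L M R) c (isNear_vec pL' qMy pR) (isNear_vec pL' v2 pR)
  simp only [node] at *
  linarith

/-- Moving `x` from the third to the first share and `y` from the third to the second one. -/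
theorem jump_octagon_last {G : SimpleGraph V} {ν : Fin 3 → Set V → ℝ}
    (hν : ∀ i, IsMonotoneValuation (ν i)) (hno : NoEFOuter G ν) {L M R : Set V} {x y : V}
    (h : IsTripartition (insert x L) (insert y M) R) (hxL : x ∉ L) (hyM : y ∉ M)
    (cL : Contiguous G L) (cLx : Contiguous G (insert x L)) (cM : Contiguous G M)
    (cMy : Contiguous G (insert y M)) (cR : Contiguous G R) (cRx : Contiguous G (insert x R))
    (cRy : Contiguous G (insert y R)) (cRyx : Contiguous G (insert y (insert x R))) :
    jump ν (node L M (insert y (insert x R))) (node L M (insert x R)) +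
      jump ν (node L M (insert x R)) (node L (insert y M) (insert x R)) +
      (jump ν (node L (insert y M) (insert x R)) (node L (insert y M) R) +
      jump ν (node L (insert y M) R) (node (insert x L) (insert y M) R)) =
    jump ν (node L M (insert y (insert x R))) (node L M (insert y R)) +
      jump ν (node L M (insert y R)) (node (insert x L) M (insert y R)) +
      (jump ν (node (insert x L) M (insert y R)) (node (insert x L) M R) +
      jump ν (node (insert x L) M R) (node (insert x L) (insert y M) R)) := by
  have hxR : x ∉ R := by have := h x; simp_all
  have hyR : y ∉ R := by have := h y; simp_all
  have hxyR : x ∉ insert y R := by have := h x; simp_all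
  have hyxR : y ∉ insert x R := by simp_all [eq_comm]
  have t1 : IsTripartition L M (insert y (insert x R)) := by
    intro z; have := h z; have := h x; have := h y; grind
  have t2 : IsTripartition L (insert y M) (insert x R) := by
    intro z; have := h z; have := h x; have := h y; grind
  have t3 : IsTripartition (insert x L) M (insert y R) := by
    intro z; have := h z; have := h x; have := h y; grind
  obtain ⟨φ₁, h1⟩ := exists_potential hν hno t1 cL cM cRyx
  obtain ⟨φ₂, h2⟩ := exists_potential hν hno t2 cL cMy cRx
  obtain ⟨φ₃, h3⟩ := exists_potential hν hno t3 cLx cM cRy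
  obtain ⟨φ₄, h4⟩ := exists_potential hν hno h cLx cMy cR
  -- Now the third share varies by two objects: `c` is near the first three allocations, and `node L
  -- M R` is near the last three.
  let c : Fin 3 → Worth V := ![worth L, worth M, worth (insert y R) ⊓ worth (insert x R)]
  have pL := isProxy_self cL
  have pLx := isProxy_self cLx
  have pL' := isProxy_insert cL hxL
  have pM := isProxy_self cM
  have pMy := isProxy_self cMy
  have qMy := isProxy_insert cM hyM
  have pR := isProxy_self cR
  have pRx := isProxy_self cRx
  have pRy := isProxy_self cRy
  have pRyx := isProxy_self cRyx
  have qRx := isProxy_insert cR hxR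
  have qRy := isProxy_insert cR hyR
  have qRyx := isProxy_insert cRx hyxR
  have qRxy := isProxy_insert cRy hxyR
  rw [Set.insert_comm] at qRxy
  have v1 := isProxy_inf_left (y := x) cR hyR
  have v2 := isProxy_inf_right (x := y) cR hxR
  have v3 := isProxy_inf_insert cRy cRx hyxR hxyR
  have aa := h1 _ (node L M (insert x R)) (isNear_vec pL pM pRyx) (isNear_vec pL pM qRyx)
  have ab := h1 _ (node L M (insert y R)) (isNear_vec pL pM pRyx) (isNear_vec pL pM qRxy)
  have ac := h1 (node L M (insert x R)) c (isNear_vec pL pM qRyx) (isNear_vec pL pM v3)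
  have ad := h1 (node L M (insert y R)) c (isNear_vec pL pM qRxy) (isNear_vec pL pM v3)
  have ba := h2 (node L M (insert x R)) _ (isNear_vec pL qMy pRx) (isNear_vec pL pMy pRx)
  have bb := h2 _ (node L (insert y M) R) (isNear_vec pL pMy pRx) (isNear_vec pL pMy qRx)
  have bc := h2 (node L M (insert x R)) c (isNear_vec pL qMy pRx) (isNear_vec pL qMy v2)
  have bd := h2 (node L (insert y M) R) (node L M R) (isNear_vec pL pMy qRx)
    (isNear_vec pL qMy qRx)
  have be := h2 (node L M R) c (isNear_vec pL qMy qRx) (isNear_vec pL qMy v2)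
  have ca := h3 (node L M (insert y R)) _ (isNear_vec pL' pM pRy) (isNear_vec pLx pM pRy)
  have cb := h3 _ (node (insert x L) M R) (isNear_vec pLx pM pRy) (isNear_vec pLx pM qRy)
  have cc := h3 (node L M (insert y R)) c (isNear_vec pL' pM pRy) (isNear_vec pL' pM v1)
  have cd := h3 (node (insert x L) M R) (node L M R) (isNear_vec pLx pM qRy)
    (isNear_vec pL' pM qRy)
  have ce := h3 (node L M R) c (isNear_vec pL' pM qRy) (isNear_vec pL' pM v1)
  have da := h4 (node L (insert y M) R) _ (isNear_vec pL' pMy pR) (isNear_vec pLx pMy pR)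
  have db := h4 (node (insert x L) M R) _ (isNear_vec pLx qMy pR) (isNear_vec pLx pMy pR)
  have dc := h4 (node L (insert y M) R) (node L M R) (isNear_vec pL' pMy pR)
    (isNear_vec pL' qMy pR)
  have dd := h4 (node (insert x L) M R) (node L M R) (isNear_vec pLx qMy pR)
    (isNear_vec pL' qMy pR)
  simp only [node] at *
  linarith

/-- Moving `x` and `y` from the third to the second share, in either order. -/
theorem jump_octagon_swap {G : SimpleGraph V} {ν : Fin 3 → Set V → ℝ}
    (hν : ∀ i, IsMonotoneValuation (ν i)) (hno : NoEFOuter G ν) {L M R : Set V} {x y : V}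
    (h : IsTripartition L (insert x M) (insert y R)) (hxM : x ∉ M) (hyR : y ∉ R)
    (cL : Contiguous G L) (cM : Contiguous G M) (cMx : Contiguous G (insert x M))
    (cMy : Contiguous G (insert y M)) (cMxy : Contiguous G (insert x (insert y M)))
    (cR : Contiguous G R) (cRx : Contiguous G (insert x R))
    (cRy : Contiguous G (insert y R)) (cRxy : Contiguous G (insert x (insert y R))) :
    jump ν (node L M (insert x (insert y R))) (node L M (insert y R)) +
      jump ν (node L M (insert y R)) (node L (insert x M) (insert y R)) +
      (jump ν (node L (insert x M) (insert y R)) (node L (insert x M) R) +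
      jump ν (node L (insert x M) R) (node L (insert x (insert y M)) R)) =
    jump ν (node L M (insert x (insert y R))) (node L M (insert x R)) +
      jump ν (node L M (insert x R)) (node L (insert y M) (insert x R)) +
      (jump ν (node L (insert y M) (insert x R)) (node L (insert y M) R) +
      jump ν (node L (insert y M) R) (node L (insert x (insert y M)) R)) := by
  have hyM : y ∉ M := by have := h y; simp_all
  have hxyR : x ∉ insert y R := by have := h x; simp_all
  have hxR : x ∉ R := by simp_all
  have hxyM : x ∉ insert y M := by simp_all
  have hyxM : y ∉ insert x M := by simp_all [eq_comm]
  have hyxR : y ∉ insert x R := by simp_all [eq_comm]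
  have t1 : IsTripartition L M (insert x (insert y R)) := by
    intro z; have := h z; have := h x; have := h y; grind
  have t3 : IsTripartition L (insert y M) (insert x R) := by
    intro z; have := h z; have := h x; have := h y; grind
  have t4 : IsTripartition L (insert x (insert y M)) R := by
    intro z; have := h z; have := h x; have := h y; grind
  obtain ⟨φ₁, h1⟩ := exists_potential hν hno t1 cL cM cRxy
  obtain ⟨φ₂, h2⟩ := exists_potential hν hno h cL cMx cRy
  obtain ⟨φ₃, h3⟩ := exists_potential hν hno t3 cL cMy cRx
  obtain ⟨φ₄, h4⟩ := exists_potential hν hno t4 cL cMxy cR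
  -- Two virtual corners: `c` is near the first three allocations, `d` near the last three, and the
  -- two middle regions share the side from `c` to `d`.
  let c : Fin 3 → Worth V := ![worth L, worth M, worth (insert x R) ⊓ worth (insert y R)]
  let d : Fin 3 → Worth V := ![worth L, worth (insert x M) ⊓ worth (insert y M), worth R]
  have pL := isProxy_self cL
  have pM := isProxy_self cM
  have pMx := isProxy_self cMx
  have pMy := isProxy_self cMy
  have pMxy := isProxy_self cMxy
  have qMx := isProxy_insert cM hxM
  have qMy := isProxy_insert cM hyM
  have qMxy := isProxy_insert cMy hxyM
  have qMyx := isProxy_insert cMx hyxM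
  rw [Set.insert_comm] at qMyx
  have pR := isProxy_self cR
  have pRx := isProxy_self cRx
  have pRy := isProxy_self cRy
  have pRxy := isProxy_self cRxy
  have qRx := isProxy_insert cR hxR
  have qRy := isProxy_insert cR hyR
  have qRxy := isProxy_insert cRy hxyR
  have qRyx := isProxy_insert cRx hyxR
  rw [Set.insert_comm] at qRyx
  have vM1 := isProxy_inf_left (y := y) cM hxM
  have vM2 := isProxy_inf_right (x := x) cM hyM
  have vM3 := isProxy_inf_insert cMx cMy hxyM hyxM
  have vR1 := isProxy_inf_left (y := y) cR hxR
  have vR2 := isProxy_inf_right (x := x) cR hyR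
  have vR3 := isProxy_inf_insert cRx cRy hxyR hyxR
  have aa := h1 _ (node L M (insert y R)) (isNear_vec pL pM pRxy) (isNear_vec pL pM qRxy)
  have ab := h1 _ (node L M (insert x R)) (isNear_vec pL pM pRxy) (isNear_vec pL pM qRyx)
  have ac := h1 (node L M (insert y R)) c (isNear_vec pL pM qRxy) (isNear_vec pL pM vR3)
  have ad := h1 (node L M (insert x R)) c (isNear_vec pL pM qRyx) (isNear_vec pL pM vR3)
  have ba := h2 (node L M (insert y R)) _ (isNear_vec pL qMx pRy) (isNear_vec pL pMx pRy)
  have bb := h2 _ (node L (insert x M) R) (isNear_vec pL pMx pRy) (isNear_vec pL pMx qRy)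
  have bc := h2 (node L M (insert y R)) c (isNear_vec pL qMx pRy) (isNear_vec pL qMx vR2)
  have bd := h2 (node L (insert x M) R) d (isNear_vec pL pMx qRy) (isNear_vec pL vM1 qRy)
  have be := h2 c d (isNear_vec pL qMx vR2) (isNear_vec pL vM1 qRy)
  have ca := h3 (node L M (insert x R)) _ (isNear_vec pL qMy pRx) (isNear_vec pL pMy pRx)
  have cb := h3 _ (node L (insert y M) R) (isNear_vec pL pMy pRx) (isNear_vec pL pMy qRx)
  have cc := h3 (node L M (insert x R)) c (isNear_vec pL qMy pRx) (isNear_vec pL qMy vR1)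
  have cd := h3 (node L (insert y M) R) d (isNear_vec pL pMy qRx) (isNear_vec pL vM2 qRx)
  have ce := h3 c d (isNear_vec pL qMy vR1) (isNear_vec pL vM2 qRx)
  have da := h4 (node L (insert x M) R) _ (isNear_vec pL qMyx pR) (isNear_vec pL pMxy pR)
  have db := h4 (node L (insert y M) R) _ (isNear_vec pL qMxy pR) (isNear_vec pL pMxy pR)
  have dc := h4 (node L (insert x M) R) d (isNear_vec pL qMyx pR) (isNear_vec pL vM3 pR)
  have dd := h4 (node L (insert y M) R) d (isNear_vec pL qMxy pR) (isNear_vec pL vM3 pR)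
  simp only [node] at *
  linarith

/-! ### The winding of a sweep and its invariance -/

/-- The set of entries of a list. -/
def entries (w : List V) : Set V := {z | z ∈ w}

@[simp] theorem mem_entries {w : List V} {z : V} : z ∈ entries w ↔ z ∈ w := Iff.rfl

@[simp] theorem entries_nil : entries ([] : List V) = ∅ := by ext; simp

@[simp] theorem entries_cons (x : V) (w : List V) : entries (x :: w) = insert x (entries w) := by
  ext; simp

@[simp] theorem entries_append (v w : List V) : entries (v ++ w) = entries v ∪ entries w := by
  ext; simp

/-- The total jump while the objects of a list pass one by one from the third share to the second,
where `L` is the first share, and `P` and `T` are the other objects of the second and third. -/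
noncomputable def wind (ν : Fin 3 → Set V → ℝ) (L : Set V) : Set V → List V → Set V → ℤ
  | _, [], _ => 0
  | P, y :: q, T =>
    jump ν (node L P (insert y (entries q ∪ T))) (node L P (entries q ∪ T)) +
      jump ν (node L P (entries q ∪ T)) (node L (insert y P) (entries q ∪ T)) +
      wind ν L (insert y P) q T

theorem wind_append (ν : Fin 3 → Set V → ℝ) (L T : Set V) (p q : List V) (P : Set V) :
    wind ν L P (p ++ q) T = wind ν L P p (entries q ∪ T) + wind ν L (P ∪ entries p) q T := by
  induction p generalizing P with
  | nil => simp [wind]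
  | cons y p ih =>
    have h : insert y P ∪ entries p = P ∪ insert y (entries p) := by ext; simp; tauto
    simp [wind, ih, h, Set.union_assoc, add_assoc]

/-- The two sweeps bound a strip of octagons, one for each entry of `q`, in which `x` passes from
the second share to the first. The common sides of consecutive octagons cancel. -/
theorem wind_strip_first {G : SimpleGraph V} {ν : Fin 3 → Set V → ℝ}
    (hν : ∀ i, IsMonotoneValuation (ν i)) (hno : NoEFOuter G ν) {L : Set V} {x : V}
    (hxL : x ∉ L) (cL : Contiguous G L) (cLx : Contiguous G (insert x L)) (q : List V)
    (P : Set V) (h : IsTripartition (insert x L) P (entries q)) (hq : q.Nodup)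
    (hc : ∀ q₁ q₂, q = q₁ ++ q₂ → Contiguous G (P ∪ entries q₁) ∧
      Contiguous G (insert x (P ∪ entries q₁)) ∧ Contiguous G (entries q₂)) :
    wind ν L (insert x P) q ∅ +
      (jump ν (node L (insert x (P ∪ entries q)) ∅) (node L (P ∪ entries q) ∅) +
      jump ν (node L (P ∪ entries q) ∅) (node (insert x L) (P ∪ entries q) ∅)) =
    jump ν (node L (insert x P) (entries q)) (node L P (entries q)) +
      jump ν (node L P (entries q)) (node (insert x L) P (entries q)) +
      wind ν (insert x L) P q ∅ := by
  induction q generalizing P with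
  | nil => simp [wind]
  | cons y q ih =>
    have h' : IsTripartition (insert x L) (insert y P) (entries q) := by
      intro z; have := h z; have := List.nodup_cons.1 hq; simp at *; grind
    have hyP : y ∉ P := by have := h y; simp at this; tauto
    have hu : insert y P ∪ entries q = P ∪ insert y (entries q) := by ext; simp; tauto
    have ih' := ih (insert y P) h' (List.nodup_cons.1 hq).2 fun q₁ q₂ e => by
      have := hc (y :: q₁) q₂ (by simp [e])
      have hu : insert y P ∪ entries q₁ = P ∪ insert y (entries q₁) := by ext; simp; tauto
      simpa [hu] using this
    obtain ⟨c1, c2, c3⟩ := hc [] _ rfl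
    obtain ⟨c4, c5, c6⟩ := hc [y] q rfl
    simp only [entries_nil, entries_cons, Set.union_empty, Set.union_insert] at c1 c2 c3 c4 c5 c6
    have key := jump_octagon_first hν hno h' hxL hyP cL cLx c1 c2 c4 c5 c6 c3
    simp only [hu] at ih'
    simp only [wind, entries_cons, Set.union_empty, Set.insert_comm y x] at *
    linarith

/-- The same strip, with `x` passing to the first share from the far end of the third. -/
theorem wind_strip_last {G : SimpleGraph V} {ν : Fin 3 → Set V → ℝ}
    (hν : ∀ i, IsMonotoneValuation (ν i)) (hno : NoEFOuter G ν) {L : Set V} {x : V}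
    (hxL : x ∉ L) (cL : Contiguous G L) (cLx : Contiguous G (insert x L)) (q : List V)
    (P : Set V) (h : IsTripartition (insert x L) P (entries q)) (hq : q.Nodup)
    (hc : ∀ q₁ q₂, q = q₁ ++ q₂ → Contiguous G (P ∪ entries q₁) ∧
      Contiguous G (insert x (entries q₂)) ∧ Contiguous G (entries q₂)) :
    wind ν L P q {x} +
      (jump ν (node L (P ∪ entries q) {x}) (node L (P ∪ entries q) ∅) +
      jump ν (node L (P ∪ entries q) ∅) (node (insert x L) (P ∪ entries q) ∅)) =
    jump ν (node L P (insert x (entries q))) (node L P (entries q)) +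
      jump ν (node L P (entries q)) (node (insert x L) P (entries q)) +
      wind ν (insert x L) P q ∅ := by
  induction q generalizing P with
  | nil => simp [wind]
  | cons y q ih =>
    have h' : IsTripartition (insert x L) (insert y P) (entries q) := by
      intro z; have := h z; have := List.nodup_cons.1 hq; simp at *; grind
    have hyP : y ∉ P := by have := h y; simp at this; tauto
    have hu : insert y P ∪ entries q = P ∪ insert y (entries q) := by ext; simp; tauto
    have ih' := ih (insert y P) h' (List.nodup_cons.1 hq).2 fun q₁ q₂ e => by
      have := hc (y :: q₁) q₂ (by simp [e])
      have hu : insert y P ∪ entries q₁ = P ∪ insert y (entries q₁) := by ext; simp; tauto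
      simpa [hu] using this
    obtain ⟨c1, c2, c3⟩ := hc [] _ rfl
    obtain ⟨c4, c5, c6⟩ := hc [y] q rfl
    simp only [entries_nil, entries_cons, Set.union_empty, Set.union_insert] at c1 c2 c3 c4 c5 c6
    rw [Set.insert_comm] at c2
    have key := jump_octagon_last hν hno h' hxL hyP cL cLx c1 c4 c6 c5 c3 c2
    simp only [hu] at ih'
    simp only [wind, entries_cons, Set.union_empty, Set.union_singleton,
      Set.insert_comm x y] at *
    linarith

/-- The list `w` orders the complement of the contiguous set `L` so that its initial and final
segments are contiguous. -/
structure IsSweep (G : SimpleGraph V) (L : Set V) (w : List V) : Prop where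
  nodup : w.Nodup
  mem_iff : ∀ z, z ∈ L ↔ z ∉ w
  contiguous : Contiguous G L
  segments : ∀ p q, w = p ++ q → Contiguous G (entries p) ∧ Contiguous G (entries q)

/-- Positivity excludes an empty share as a favourite, so the walk avoids corner 1 and with it the
side that is counted. -/
theorem jump_eq_zero_of_empty_second {ν : Fin 3 → Set V → ℝ}
    (hν : ∀ i, IsMonotoneValuation (ν i)) (hpos : ∀ i, ∀ S : Set V, S.Nonempty → 0 < ν i S)
    {A C A' C' : Set V} (h : (A ∪ C).Nonempty) (h' : (A' ∪ C').Nonempty) :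
    jump ν (node A ∅ C) (node A' ∅ C') = 0 := by
  have h1 : ∀ i, ∀ A C : Set V, (A ∪ C).Nonempty → label (ν i) (node A ∅ C) ≠ 1 := by
    intro i A C hne e
    have := label_node_nonempty (hν i) (hpos i) (A := A) (B := ∅) (C := C) (by simpa using hne)
    simp [e] at this
  have h2 : ∀ p q : Fin 3, p ≠ 1 → q ≠ 1 → crossing p q = 0 := by decide
  simp [jump, h2 _ _ (h1 0 _ _ h) (h1 1 _ _ h), h2 _ _ (h1 1 _ _ h) (h1 0 _ _ h')]

theorem jump_eq_zero_of_empty_third {ν : Fin 3 → Set V → ℝ}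
    (hν : ∀ i, IsMonotoneValuation (ν i)) (hpos : ∀ i, ∀ S : Set V, S.Nonempty → 0 < ν i S)
    {A B A' B' : Set V} (h : (A ∪ B).Nonempty) (h' : (A' ∪ B').Nonempty) :
    jump ν (node A B ∅) (node A' B' ∅) = 0 := by
  have h1 : ∀ i, ∀ A B : Set V, (A ∪ B).Nonempty → label (ν i) (node A B ∅) ≠ 2 := by
    intro i A B hne e
    have := label_node_nonempty (hν i) (hpos i) (A := A) (B := B) (C := ∅) (by simpa using hne)
    simp [e] at this
  have h2 : ∀ p q : Fin 3, p ≠ 2 → q ≠ 2 → crossing p q = 0 := by decide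
  simp [jump, h2 _ _ (h1 0 _ _ h) (h1 1 _ _ h), h2 _ _ (h1 1 _ _ h) (h1 0 _ _ h')]

/-- The ends of the strip contribute nothing. At the start, giving `x` to the second share and
taking it back cancels by `jump_antisymm`; all other steps there keep the second share empty, and
those at the finish keep the third one empty. -/
theorem wind_eat_first {G : SimpleGraph V} {ν : Fin 3 → Set V → ℝ} [Nontrivial V]
    (hν : ∀ i, IsMonotoneValuation (ν i)) (hpos : ∀ i, ∀ S : Set V, S.Nonempty → 0 < ν i S)
    (hno : NoEFOuter G ν) {L : Set V} {x : V} {w : List V}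
    (h : IsSweep G L (x :: w)) (h' : IsSweep G (insert x L) w) :
    wind ν L ∅ (x :: w) ∅ = wind ν (insert x L) ∅ w ∅ := by
  have hxL : x ∉ L := by simp [h.mem_iff]
  have ht : IsTripartition (insert x L) ∅ (entries w) := by
    intro z; have := h'.mem_iff z; simp at *; tauto
  have hs := wind_strip_first hν hno hxL h.contiguous h'.contiguous w ∅ ht h'.nodup
    fun q₁ q₂ e => by
      have h1 := h'.segments _ _ e
      have h2 := h.segments (x :: q₁) q₂ (by simp [e])
      simp at h1 h2 ⊢
      exact ⟨h1.1, h2.1, h1.2⟩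
  -- A second vertex keeps some share nonempty while `x` is unassigned.
  obtain ⟨z, hz⟩ := exists_ne x
  have hne : (L ∪ entries w).Nonempty := ⟨z, by
    have := h.mem_iff z
    simp [hz] at this ⊢
    tauto⟩
  have cw := (h'.segments [] w rfl).2
  have cx := (h.segments [x] w rfl).1
  have c0 := (h'.segments [] w rfl).1
  have hxw := (List.nodup_cons.1 h.nodup).1
  have hta : IsTripartition L {x} (entries w) := by
    intro z; have := h.mem_iff z; simp at *; grind
  simp only [entries_cons, entries_nil, insert_empty_eq] at cx c0
  have nL := isProxy_self h.contiguous
  have nw := isProxy_self cw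
  have hq : IsProxy G (worth ∅) {x} := by simpa using isProxy_insert c0 (Set.notMem_empty x)
  have ha := jump_antisymm hν hno hta h.contiguous cx cw
    (n := node L ∅ (entries w)) (n' := node L {x} (entries w)) (isNear_vec nL hq nw)
    (isNear_vec nL (isProxy_self cx) nw)
  have z1 := jump_eq_zero_of_empty_second hν hpos (A := L) (C := insert x (entries w))
    (A' := L) (C' := entries w) ⟨x, by simp⟩ hne
  have z2 := jump_eq_zero_of_empty_second hν hpos (A := L) (C := entries w)
    (A' := insert x L) (C' := entries w) hne ⟨x, by simp⟩
  have z3 := jump_eq_zero_of_empty_third hν hpos (A := L) (B := insert x (entries w))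
    (A' := L) (B' := entries w) ⟨x, by simp⟩ hne
  have z4 := jump_eq_zero_of_empty_third hν hpos (A := L) (B := entries w)
    (A' := insert x L) (B' := entries w) hne ⟨x, by simp⟩
  simp only [wind, Set.empty_union, Set.union_empty, insert_empty_eq] at *
  linarith

/-- The step that releases `x` from the third share belongs to both routes and cancels. The other
steps at the ends of the strip have an empty second or third share. -/
theorem wind_eat_last {G : SimpleGraph V} {ν : Fin 3 → Set V → ℝ} [Nontrivial V]
    (hν : ∀ i, IsMonotoneValuation (ν i)) (hpos : ∀ i, ∀ S : Set V, S.Nonempty → 0 < ν i S)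
    (hno : NoEFOuter G ν) {L : Set V} {x : V} {w : List V}
    (h : IsSweep G L (w ++ [x])) (h' : IsSweep G (insert x L) w) :
    wind ν L ∅ (w ++ [x]) ∅ = wind ν (insert x L) ∅ w ∅ := by
  have hxL : x ∉ L := by simp [h.mem_iff]
  have ht : IsTripartition (insert x L) ∅ (entries w) := by
    intro z; have := h'.mem_iff z; simp at *; tauto
  have hs := wind_strip_last hν hno hxL h.contiguous h'.contiguous w ∅ ht h'.nodup
    fun q₁ q₂ e => by
      have h1 := h'.segments _ _ e
      have h2 := h.segments q₁ (q₂ ++ [x]) (by simp [e])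
      simp at h1 h2 ⊢
      exact ⟨h1.1, h2.2, h1.2⟩
  obtain ⟨z, hz⟩ := exists_ne x
  have hne : (L ∪ entries w).Nonempty := ⟨z, by
    have := h.mem_iff z
    simp [hz] at this ⊢
    tauto⟩
  have cw := (h'.segments w [] (by simp)).1
  have cx := (h.segments w [x] rfl).2
  have c0 := (h'.segments [] w rfl).1
  have hta : IsTripartition L (entries w) {x} := by
    intro z
    have := h.mem_iff z
    have := h'.mem_iff z
    have := h.mem_iff x
    have := h'.mem_iff x
    simp at *
    grind
  simp only [entries_cons, entries_nil, insert_empty_eq] at cx c0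
  have nL := isProxy_self h.contiguous
  have nw := isProxy_self cw
  have hq : IsProxy G (worth ∅) {x} := by simpa using isProxy_insert c0 (Set.notMem_empty x)
  have z1 := jump_eq_zero_of_empty_second hν hpos (A := L) (C := insert x (entries w))
    (A' := L) (C' := entries w) ⟨x, by simp⟩ hne
  have z2 := jump_eq_zero_of_empty_second hν hpos (A := L) (C := entries w)
    (A' := insert x L) (C' := entries w) hne ⟨x, by simp⟩
  have z3 := jump_eq_zero_of_empty_third hν hpos (A := L) (B := entries w)
    (A' := L) (B' := insert x (entries w)) hne ⟨x, by simp⟩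
  have z4 := jump_eq_zero_of_empty_third hν hpos (A := L) (B := entries w)
    (A' := insert x L) (B' := entries w) hne ⟨x, by simp⟩
  rw [wind_append]
  simp only [wind, entries_cons, entries_nil, Set.empty_union, Set.union_empty,
    insert_empty_eq] at *
  linarith

/-- The two routes differ only around one octagon. -/
theorem wind_swap {G : SimpleGraph V} {ν : Fin 3 → Set V → ℝ}
    (hν : ∀ i, IsMonotoneValuation (ν i)) (hno : NoEFOuter G ν) {L : Set V} {x y : V}
    {p q : List V} (h : IsSweep G L (p ++ x :: y :: q)) (h' : IsSweep G L (p ++ y :: x :: q)) :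
    wind ν L ∅ (p ++ x :: y :: q) ∅ = wind ν L ∅ (p ++ y :: x :: q) ∅ := by
  have hn := h.nodup
  have ht : IsTripartition L (insert x (entries p)) (insert y (entries q)) := by
    intro z
    have := h.mem_iff z
    simp only [List.nodup_append, List.nodup_cons] at hn
    simp at *
    grind
  have hxp : x ∉ entries p := by
    simp only [List.nodup_append, List.nodup_cons] at hn
    simp at *
    grind
  have hyq : y ∉ entries q := by
    simp only [List.nodup_append, List.nodup_cons] at hn
    simp at *
    grind
  have a1 := h.segments p (x :: y :: q) rfl
  have a2 := h.segments (p ++ [x]) (y :: q) (by simp)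
  have a3 := h.segments (p ++ [x, y]) q (by simp)
  have a4 := h'.segments (p ++ [y]) (x :: q) (by simp)
  simp only [entries_append, entries_cons, entries_nil, Set.union_insert, Set.union_empty]
    at a1 a2 a3 a4
  have key := jump_octagon_swap hν hno ht hxp hyq h.contiguous a1.1 a2.1 a4.1 a3.1 a3.2 a4.2
    a2.2 a1.2
  rw [wind_append, wind_append]
  simp only [wind, entries_cons, Set.empty_union, Set.union_empty,
    Set.insert_comm y x] at *
  linarith

/-- Only corners 1 and 2 occur, and between these a crossing is a difference of a potential, so the
sum telescopes without any contiguity. -/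
theorem wind_empty_first {ν : Fin 3 → Set V → ℝ} [Nontrivial V]
    (hν : ∀ i, IsMonotoneValuation (ν i)) (hpos : ∀ i, ∀ S : Set V, S.Nonempty → 0 < ν i S)
    (q : List V) (P : Set V) (hq : ∀ z, z ∈ P ∨ z ∈ q) :
    wind ν ∅ P q ∅ = crossing 2 (label (ν 0) (node ∅ (P ∪ entries q) ∅)) -
      crossing 2 (label (ν 0) (node ∅ P (entries q))) := by
  have h1 : ∀ i, ∀ B C : Set V, (B ∪ C).Nonempty → label (ν i) (node ∅ B C) ≠ 0 := by
    intro i B C hne e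
    have := label_node_nonempty (hν i) (hpos i) (A := ∅) (B := B) (C := C) (by simpa using hne)
    simp [e] at this
  have h2 : ∀ p q : Fin 3, p ≠ 0 → q ≠ 0 → crossing p q = crossing 2 q - crossing 2 p := by
    decide
  have h3 : ∀ B C B' C' : Set V, (B ∪ C).Nonempty → (B' ∪ C').Nonempty →
      jump ν (node ∅ B C) (node ∅ B' C') = crossing 2 (label (ν 0) (node ∅ B' C')) -
        crossing 2 (label (ν 0) (node ∅ B C)) := by
    intro B C B' C' h h'
    rw [jump, h2 _ _ (h1 0 _ _ h) (h1 1 _ _ h), h2 _ _ (h1 1 _ _ h) (h1 0 _ _ h')]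
    ring
  induction q generalizing P with
  | nil => simp [wind]
  | cons y q ih =>
    obtain ⟨z, hz⟩ := exists_ne y
    have hne : (P ∪ entries q).Nonempty := ⟨z, by have := hq z; simp [hz] at this ⊢; exact this⟩
    have hu : insert y P ∪ entries q = P ∪ insert y (entries q) := by ext; simp; tauto
    rw [wind, ih _ fun z => by have := hq z; simp at this ⊢; tauto, Set.union_empty,
      h3 _ _ _ _ ⟨y, by simp⟩ hne, h3 _ _ _ _ hne ⟨y, by simp⟩, hu, entries_cons]
    ring

/-- At both extremes a single share holds everything and is the forced favourite, so the telescoped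
sum is -1. -/
theorem wind_sweep_empty {G : SimpleGraph V} {ν : Fin 3 → Set V → ℝ} [Nontrivial V]
    (hν : ∀ i, IsMonotoneValuation (ν i)) (hpos : ∀ i, ∀ S : Set V, S.Nonempty → 0 < ν i S)
    {w : List V} (h : IsSweep G ∅ w) : wind ν ∅ ∅ w ∅ ≠ 0 := by
  have hw : entries w = Set.univ := by
    ext z; have := h.mem_iff z; simp at *; exact this
  have hl : ∀ (ν : Set V → ℝ) (n : Fin 3 → Worth V) (p : Fin 3),
      (∀ q, q ≠ p → n q ν < n p ν) → label ν n = p := by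
    intro ν n p hp
    by_contra hne
    exact (hp _ hne).not_ge (le_label ν n p)
  have hu : ∀ i, ν i ∅ < ν i Set.univ := fun i => by
    rw [(hν i).empty]; exact hpos i _ Set.univ_nonempty
  rw [wind_empty_first hν hpos _ _ fun z => Or.inr (by have := h.mem_iff z; simpa using this), hw,
    Set.empty_union,
    hl (ν 0) (node ∅ Set.univ ∅) 1 (fun q hq => ?_), hl (ν 0) (node ∅ ∅ Set.univ) 2 (fun q hq => ?_)]
  · decide
  · fin_cases q <;> simp_all [node, worth]
  · fin_cases q <;> simp_all [node, worth]

/-! ### Reduction to valuations positive on nonempty sets -/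

/-- A real-valued set function, raised by one on nonempty sets. -/
noncomputable def raise (ν : Set V → ℝ) (S : Set V) : ℝ :=
  open Classical in if S.Nonempty then ν S + 1 else 0

theorem raise_of_nonempty (ν : Set V → ℝ) {S : Set V} (h : S.Nonempty) :
    raise ν S = ν S + 1 := if_pos h

@[simp] theorem raise_empty (ν : Set V → ℝ) : raise ν ∅ = 0 := if_neg Set.not_nonempty_empty

theorem IsMonotoneValuation.nonneg {ν : Set V → ℝ} (h : IsMonotoneValuation ν) (S : Set V) :
    0 ≤ ν S := h.empty ▸ h.mono (Set.empty_subset S)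

theorem IsMonotoneValuation.raise_pos {ν : Set V → ℝ} (h : IsMonotoneValuation ν) {S : Set V}
    (hS : S.Nonempty) : 0 < raise ν S := by
  rw [raise_of_nonempty ν hS]
  linarith [h.nonneg S]

theorem IsMonotoneValuation.raise {ν : Set V → ℝ} (h : IsMonotoneValuation ν) :
    IsMonotoneValuation (raise ν) := by
  refine ⟨raise_empty ν, fun X Y hXY => ?_⟩
  rcases X.eq_empty_or_nonempty with rfl | hX
  · rcases Y.eq_empty_or_nonempty with rfl | hY
    · rfl
    · simpa using (h.raise_pos hY).le
  · rw [raise_of_nonempty ν hX, raise_of_nonempty ν (hX.mono hXY)]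
    linarith [h.mono hXY]

theorem IsMonotoneValuation.le_of_raise_le {ν : Set V → ℝ} (h : IsMonotoneValuation ν)
    {X Y : Set V} (hXY : _root_.raise ν X ≤ _root_.raise ν Y) : ν X ≤ ν Y := by
  rcases X.eq_empty_or_nonempty with rfl | hX
  · rw [h.empty]; exact h.nonneg Y
  · rcases Y.eq_empty_or_nonempty with rfl | hY
    · rw [raise_empty] at hXY
      exact absurd (h.raise_pos hX) hXY.not_gt
    · rw [raise_of_nonempty ν hX, raise_of_nonempty ν hY] at hXY
      linarith

/-- It suffices to consider valuations that are positive on nonempty sets. -/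
theorem guaranteesEFOuter_of_pos {G : SimpleGraph V}
    (h : ∀ ν : Fin 3 → Set V → ℝ, (∀ i, IsMonotoneValuation (ν i)) →
      (∀ i, ∀ S : Set V, S.Nonempty → 0 < ν i S) → ¬ NoEFOuter G ν) :
    GuaranteesEFOuter G 1 3 := by
  intro ν hν
  obtain ⟨A, h1, h2, h3⟩ := not_not.1 (h (fun i => raise (ν i)) (fun i => (hν i).raise)
    fun i S hS => (hν i).raise_pos hS)
  refine ⟨A, h1, h2, fun i j hij => ?_⟩
  obtain ⟨X, hX1, hX2, hX3, hX4⟩ := h3 i j hij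
  exact ⟨X, hX1, hX2, hX3, (hν i).le_of_raise_le hX4⟩

end Winding

/-! ### Connected sets built vertex by vertex -/

section Growth

variable {V : Type*} {G : SimpleGraph V}

theorem contiguous_empty : Contiguous G ∅ := fun x => x.2.elim

theorem contiguous_singleton (x : V) : Contiguous G {x} := by
  have : Subsingleton ({x} : Set V) := Set.subsingleton_coe _ |>.2 Set.subsingleton_singleton
  exact SimpleGraph.Preconnected.of_subsingleton

theorem Contiguous.insert {S : Set V} (hS : Contiguous G S) {x y : V} (hy : y ∈ S)
    (h : G.Adj y x) : Contiguous G (insert x S) := by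
  have hc : (G.induce S).Connected := (SimpleGraph.connected_iff _).2 ⟨hS, ⟨⟨y, hy⟩⟩⟩
  have hp := SimpleGraph.induce_pair_connected_of_adj h
  have := SimpleGraph.induce_union_connected hc.preconnected hp.preconnected ⟨y, hy, by simp⟩
  have e : S ∪ {y, x} = Insert.insert x S := by
    ext z
    simp
    grind
  rw [e] at this
  exact this.preconnected

/-- Each entry of the list is adjacent to `S` or to an earlier entry. -/
def Grows (G : SimpleGraph V) : Set V → List V → Prop
  | _, [] => True
  | S, x :: w => (∃ y ∈ S, G.Adj y x) ∧ Grows G (insert x S) w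

theorem grows_append {S : Set V} {v w : List V} :
    Grows G S (v ++ w) ↔ Grows G S v ∧ Grows G (S ∪ entries v) w := by
  induction v generalizing S with
  | nil => simp [Grows]
  | cons x v ih =>
    have : insert x S ∪ entries v = S ∪ insert x (entries v) := by ext; simp; tauto
    simp [Grows, ih, this, and_assoc]

theorem grows_of_isChain {S : Set V} {x : V} {w : List V} (hx : x ∈ S)
    (h : (x :: w).IsChain G.Adj) : Grows G S w := by
  induction w generalizing S x with
  | nil => trivial
  | cons y w ih =>
    rw [List.isChain_cons_cons] at h
    exact ⟨⟨x, hx, h.1⟩, ih (Set.mem_insert _ _) h.2⟩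

theorem Contiguous.union_entries {S : Set V} (hS : Contiguous G S) {w : List V}
    (h : Grows G S w) : Contiguous G (S ∪ entries w) := by
  induction w generalizing S with
  | nil => simpa using hS
  | cons x w ih =>
    obtain ⟨⟨y, hy, hyx⟩, hw⟩ := h
    have e : S ∪ entries (x :: w) = Insert.insert x S ∪ entries w := by ext; simp; tauto
    rw [e]
    exact ih (hS.insert hy hyx) hw

/-- Each entry of the list but the first is adjacent to an earlier entry. -/
def Builds (G : SimpleGraph V) : List V → Prop
  | [] => True
  | x :: w => Grows G {x} w

theorem Builds.contiguous {w : List V} (h : Builds G w) : Contiguous G (entries w) := by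
  cases w with
  | nil => simpa using contiguous_empty
  | cons x w =>
    rw [entries_cons, ← Set.singleton_union]
    exact (contiguous_singleton x).union_entries h

theorem Builds.left {v w : List V} (h : Builds G (v ++ w)) : Builds G v := by
  cases v with
  | nil => trivial
  | cons x v => exact (grows_append.1 h).1

theorem Builds.append {x : V} {v w : List V} (hx : x ∈ v) (h : Builds G v)
    (hw : Grows G (entries v) w) : Builds G (v ++ w) := by
  cases v with
  | nil => simp at hx
  | cons y v =>
    refine grows_append.2 ⟨h, ?_⟩
    have e : {y} ∪ entries v = entries (y :: v) := by ext; simp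
    rwa [e]

theorem builds_of_isChain {w : List V} (h : w.IsChain G.Adj) : Builds G w := by
  cases w with
  | nil => trivial
  | cons x w => exact grows_of_isChain rfl h

theorem contiguous_of_isChain {w : List V} (h : w.IsChain G.Adj) : Contiguous G (entries w) :=
  (builds_of_isChain h).contiguous

theorem isChain_reverse_adj {w : List V} (h : w.IsChain G.Adj) : w.reverse.IsChain G.Adj := by
  rw [List.isChain_reverse]
  exact h.imp fun _ _ h => h.symm

@[simp] theorem entries_reverse (w : List V) : entries w.reverse = entries w := by ext; simp

/-- Final segments are initial segments of the reversed list, as with st-numberings. -/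
theorem isSweep_of_builds {L : Set V} {w : List V} (hn : w.Nodup) (hm : ∀ z, z ∈ L ↔ z ∉ w)
    (hL : Contiguous G L) (h : Builds G w) (h' : Builds G w.reverse) : IsSweep G L w := by
  refine ⟨hn, hm, hL, fun p q e => ⟨?_, ?_⟩⟩
  · rw [e] at h
    exact h.left.contiguous
  · rw [e, List.reverse_append] at h'
    simpa using h'.left.contiguous

end Growth

/-! ### Reordering a sweep by adjacent swaps -/

section Swaps

variable {V : Type*} {G : SimpleGraph V} {ν : Fin 3 → Set V → ℝ}

theorem sweep_move (hν : ∀ i, IsMonotoneValuation (ν i)) (hno : NoEFOuter G ν) {x : V}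
    {L : Set V} {X : List V} (t s : List V)
    (h : ∀ s' t', s ++ t = s' ++ t' → IsSweep G L (s' ++ x :: t' ++ X)) :
    wind ν L ∅ (s ++ x :: t ++ X) ∅ = wind ν L ∅ (s ++ t ++ x :: X) ∅ := by
  induction t generalizing s with
  | nil => simp
  | cons y t ih =>
    have h1 := h s (y :: t) rfl
    have h2 := h (s ++ [y]) t (by simp)
    have h3 := ih (s ++ [y]) fun s' t' e => h s' t' (by simpa using e)
    simp only [List.append_assoc, List.cons_append, List.nil_append] at h1 h2 h3 ⊢
    rw [wind_swap hν hno h1 h2, h3]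

/-- The first entry of `P` is moved to just before `X`, and so on with the rest. Every initial
segment met on the way is, as a set, a stretch of `P` or all of `P` with an initial segment of `X`;
the hypotheses cover these sets and their complements in the list. -/
theorem sweep_reverse (hν : ∀ i, IsMonotoneValuation (ν i)) (hno : NoEFOuter G ν)
    {L : Set V} (P X : List V) (hn : (P ++ X).Nodup) (hm : ∀ z, z ∈ L ↔ z ∉ P ++ X)
    (hL : Contiguous G L)
    (h₁ : ∀ s m t, P = s ++ m ++ t →
      Contiguous G (entries m) ∧ Contiguous G (entries (s ++ t ++ X)))
    (h₂ : ∀ p q, X = p ++ q → Contiguous G (entries (P ++ p)) ∧ Contiguous G (entries q)) :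
    IsSweep G L (P.reverse ++ X) ∧ wind ν L ∅ (P ++ X) ∅ = wind ν L ∅ (P.reverse ++ X) ∅ := by
  induction P generalizing X with
  | nil =>
    refine ⟨⟨hn, hm, hL, fun p q e => ?_⟩, rfl⟩
    simpa using h₂ p q e
  | cons x P ih =>
    have hs : ∀ s t, P = s ++ t → IsSweep G L (s ++ x :: t ++ X) := by
      intro s t e
      have hperm : (s ++ x :: t ++ X).Perm (x :: P ++ X) := by
        rw [e]
        exact List.perm_middle.append_right X
      refine ⟨hperm.nodup_iff.2 hn, fun z => by rw [hm, hperm.mem_iff], hL, fun p q hpq => ?_⟩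
      rcases List.append_eq_append_iff.1 hpq with ⟨r, hp, hr⟩ | ⟨r, hp, hr⟩
      · have := h₂ r q hr
        have e1 : entries p = entries (x :: P ++ r) := by
          ext z; simp [hp, e]
        rw [e1]
        exact this
      · rcases List.append_eq_append_iff.1 hp with ⟨k, hk, hk'⟩ | ⟨k, hk, hk'⟩
        · rcases k with _ | ⟨y, k⟩
          · have := (h₁ [x] s t (by simp [e])).1
            have h3 := (h₁ [x] s t (by simp [e])).2
            simp only [List.nil_append] at hk'
            rw [hr, ← hk', hk]
            exact ⟨by simpa using this, by simpa using h3⟩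
          · simp only [List.cons_append, List.cons.injEq] at hk'
            obtain ⟨rfl, rfl⟩ := hk'
            have h3 := h₁ [] (x :: s ++ k) r (by simp [e])
            have e1 : entries p = entries (x :: s ++ k) := by
              ext z; simp [hk]
            rw [e1, hr]
            simpa using h3
        · have h3 := h₁ [x] p (k ++ t) (by simp [e, hk])
          have e1 : entries q = entries ([x] ++ (k ++ t) ++ X) := by
            ext z; simp [hr, hk']
          rw [e1]
          exact h3
    have hmv := sweep_move hν hno (X := X) P [] fun s' t' e => hs s' t' e
    have hperm : (P ++ x :: X).Perm (x :: P ++ X) := List.perm_middle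
    obtain ⟨h3, h4⟩ := ih (x :: X) (hperm.nodup_iff.2 hn) (fun z => by rw [hm, hperm.mem_iff])
      (fun s m t e => by
        have := h₁ (x :: s) m t (by simp [e])
        refine ⟨this.1, ?_⟩
        have e1 : entries (s ++ t ++ x :: X) = entries (x :: s ++ t ++ X) := by
          ext z; simp
        rw [e1]
        exact this.2)
      (fun p q e => by
        rcases p with _ | ⟨y, p⟩
        · have := h₁ [x] P [] (by simp)
          simp only [List.nil_append] at e
          rw [← e]
          simpa using this
        · simp only [List.cons_append, List.cons.injEq] at e
          obtain ⟨rfl, e⟩ := e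
          have := h₂ p q e
          have e1 : entries (P ++ x :: p) = entries (x :: P ++ p) := by ext z; simp
          rw [e1]
          exact this)
    simp only [List.reverse_cons, List.append_assoc, List.cons_append, List.nil_append] at *
    exact ⟨h3, hmv.trans h4⟩

end Swaps

/-! ### Absorbing an end of a sweep into the first share -/

section Sweep

variable {V : Type*} [Nontrivial V] {G : SimpleGraph V} {ν : Fin 3 → Set V → ℝ}

/-- Final segments of the shortened lists are inherited from the full one; only initial segments
need the hypothesis `hb`. -/
theorem sweep_eat_prefix (hν : ∀ i, IsMonotoneValuation (ν i))
    (hpos : ∀ i, ∀ S : Set V, S.Nonempty → 0 < ν i S) (hno : NoEFOuter G ν) {u v : List V}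
    {L : Set V} (h : IsSweep G L (u ++ v))
    (hL : ∀ u₁ u₂, u = u₁ ++ u₂ → Contiguous G (L ∪ entries u₁))
    (hb : ∀ u₁ u₂ p q, u = u₁ ++ u₂ → u₂ ++ v = p ++ q → Contiguous G (entries p)) :
    IsSweep G (L ∪ entries u) v ∧
      wind ν L ∅ (u ++ v) ∅ = wind ν (L ∪ entries u) ∅ v ∅ := by
  induction u generalizing L with
  | nil => simpa using h
  | cons x u ih =>
    have e : ∀ w, L ∪ insert x (entries w) = insert x L ∪ entries w := by
      intro w; ext; simp; tauto
    have hx : IsSweep G (insert x L) (u ++ v) := by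
      refine ⟨(List.nodup_cons.1 h.nodup).2, fun z => ?_, ?_, fun p q hpq => ⟨?_, ?_⟩⟩
      · have := h.mem_iff z
        have := (List.nodup_cons.1 h.nodup).1
        simp at *
        grind
      · simpa using hL [x] u rfl
      · exact hb [x] u p q rfl hpq
      · exact (h.segments (x :: p) q (by simp [hpq])).2
    obtain ⟨h1, h2⟩ := ih hx
      (fun u₁ u₂ hu => by simpa [e] using hL (x :: u₁) u₂ (by simp [hu]))
      (fun u₁ u₂ p q hu => hb (x :: u₁) u₂ p q (by simp [hu]))
    rw [entries_cons, e]
    exact ⟨h1, (wind_eat_first hν hpos hno h hx).trans h2⟩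

theorem sweep_eat_suffix (hν : ∀ i, IsMonotoneValuation (ν i))
    (hpos : ∀ i, ∀ S : Set V, S.Nonempty → 0 < ν i S) (hno : NoEFOuter G ν) {u v : List V}
    {L : Set V} (h : IsSweep G L (v ++ u))
    (hL : ∀ u₁ u₂, u = u₁ ++ u₂ → Contiguous G (L ∪ entries u₂))
    (hb : ∀ u₁ u₂ p q, u = u₁ ++ u₂ → v ++ u₁ = p ++ q → Contiguous G (entries q)) :
    IsSweep G (L ∪ entries u) v ∧
      wind ν L ∅ (v ++ u) ∅ = wind ν (L ∪ entries u) ∅ v ∅ := by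
  induction u using List.reverseRecOn generalizing L with
  | nil => simpa using h
  | append_singleton u x ih =>
    have e : ∀ w, L ∪ (entries w ∪ {x}) = insert x L ∪ entries w := by
      intro w; ext; simp; tauto
    rw [← List.append_assoc] at h
    have hx : IsSweep G (insert x L) (v ++ u) := by
      have hn := List.nodup_append.1 h.nodup
      refine ⟨hn.1, fun z => ?_, ?_, fun p q hpq => ⟨?_, ?_⟩⟩
      · have := h.mem_iff z
        simp at *
        grind
      · simpa using hL u [x] rfl
      · exact (h.segments p (q ++ [x]) (by simp [hpq])).1
      · exact hb u [x] p q rfl hpq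
    obtain ⟨h1, h2⟩ := ih hx
      (fun u₁ u₂ hu => by
        simpa only [entries_append, entries_cons, entries_nil, insert_empty_eq, e] using
          hL u₁ (u₂ ++ [x]) (by simp [hu]))
      (fun u₁ u₂ p q hu => hb u₁ (u₂ ++ [x]) p q (by simp [hu]))
    rw [entries_append, entries_cons, entries_nil, insert_empty_eq, e, ← List.append_assoc]
    exact ⟨h1, (wind_eat_last hν hpos hno h hx).trans h2⟩

end Sweep

/-! ### Devouring the lips -/

section LipsSweep

variable {V : Type*} {G : SimpleGraph V}

/-- Five paths whose inner vertices are listed, and which together form a lips graph. -/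
structure IsLipsPaths (G : SimpleGraph V) (a b c : V) (T₁ M₁ T₂ M₂ Lo : List V) : Prop where
  topLeft : (b :: T₁ ++ [a]).IsChain G.Adj
  midLeft : (b :: M₁ ++ [a]).IsChain G.Adj
  topRight : (c :: T₂ ++ [b]).IsChain G.Adj
  midRight : (c :: M₂ ++ [b]).IsChain G.Adj
  lower : (a :: Lo ++ [c]).IsChain G.Adj
  nodup : (T₁ ++ a :: Lo ++ (c :: T₂ ++ M₂ ++ [b] ++ M₁)).Nodup
  cover : ∀ z, z ∈ T₁ ++ a :: Lo ++ (c :: T₂ ++ M₂ ++ [b] ++ M₁)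

variable {a b c : V} {T₁ M₁ T₂ M₂ Lo : List V}

theorem isChain_left {p q : List V} (h : (p ++ q).IsChain G.Adj) : p.IsChain G.Adj :=
  (List.isChain_append.1 h).1

theorem isChain_right {p q : List V} (h : (p ++ q).IsChain G.Adj) : q.IsChain G.Adj :=
  (List.isChain_append.1 h).2.1

theorem contiguous_of_isChain_append {w p q : List V} (h : w.IsChain G.Adj) (e : w = p ++ q) :
    Contiguous G (entries p) ∧ Contiguous G (entries q) := by
  rw [e] at h
  exact ⟨contiguous_of_isChain (isChain_left h), contiguous_of_isChain (isChain_right h)⟩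

/-- The top left and the lower path are absorbed into the first share. -/
theorem IsLipsPaths.sweep_lower [Nontrivial V] {ν : Fin 3 → Set V → ℝ}
    (h : IsLipsPaths G a b c T₁ M₁ T₂ M₂ Lo) (hν : ∀ i, IsMonotoneValuation (ν i))
    (hpos : ∀ i, ∀ S : Set V, S.Nonempty → 0 < ν i S) (hno : NoEFOuter G ν) :
    IsSweep G (entries (T₁ ++ a :: Lo)) (c :: T₂ ++ M₂ ++ [b] ++ M₁) ∧
      wind ν (entries (T₁ ++ a :: Lo)) ∅ (c :: T₂ ++ M₂ ++ [b] ++ M₁) ∅ ≠ 0 := by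
  have ch : (T₁ ++ a :: Lo ++ [c]).IsChain G.Adj := by
    rw [List.append_assoc, List.cons_append]
    exact List.isChain_split.2 ⟨isChain_right (p := [b]) h.topLeft, h.lower⟩
  have tail : ∀ S : Set V, c ∈ S → Grows G S (T₂ ++ M₂ ++ [b] ++ M₁) := by
    intro S hc
    refine grows_append.2 ⟨?_, grows_of_isChain (x := b) (by simp) (isChain_left h.midLeft)⟩
    rw [List.append_assoc]
    exact grows_append.2 ⟨grows_of_isChain hc (isChain_left h.topRight),
      grows_of_isChain (x := c) (by simp [hc]) h.midRight⟩
  -- What is left of the eaten prefix is a path ending next to `c`, and both right paths grow from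
  -- `c`.
  have hb : ∀ u₁ u₂, T₁ ++ a :: Lo = u₁ ++ u₂ →
      Builds G (u₂ ++ (c :: T₂ ++ M₂ ++ [b] ++ M₁)) := by
    intro u₁ u₂ e
    rw [e, List.append_assoc] at ch
    have := Builds.append (x := c) (by simp) (builds_of_isChain (isChain_right ch))
      (tail _ (by simp))
    simpa using this
  have hr : Builds G (T₁ ++ a :: Lo ++ (c :: T₂ ++ M₂ ++ [b] ++ M₁)).reverse := by
    have r1 := isChain_reverse_adj (isChain_left h.midLeft)
    have r2 := isChain_reverse_adj h.midRight
    have r3 := isChain_reverse_adj h.topRight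
    have r4 := isChain_reverse_adj ch
    simp only [List.reverse_append, List.reverse_cons, List.reverse_nil, List.nil_append,
      List.append_assoc, List.cons_append] at r1 r2 r3 r4 ⊢
    have g1 : Grows G (entries (M₁.reverse ++ [b])) M₂.reverse := by
      refine grows_of_isChain (x := b) (by simp) (isChain_left (q := [c]) (by simpa using r2))
    have g2 : Grows G (entries (M₁.reverse ++ [b]) ∪ entries M₂.reverse)
        (T₂.reverse ++ [c]) := by
      exact grows_of_isChain (x := b) (by simp) r3
    have g3 : Grows G (entries (M₁.reverse ++ [b]) ∪ entries M₂.reverse ∪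
        entries (T₂.reverse ++ [c])) (Lo.reverse ++ a :: T₁.reverse) := by
      exact grows_of_isChain (x := c) (by simp) r4
    have := Builds.append (x := b) (by simp) (builds_of_isChain r1)
      (grows_append.2 ⟨grows_append.2 ⟨g1, by simpa using g2⟩, by
        simpa [Set.union_assoc] using g3⟩)
    simpa using this
  have h0 : IsSweep G ∅ (T₁ ++ a :: Lo ++ (c :: T₂ ++ M₂ ++ [b] ++ M₁)) :=
    isSweep_of_builds h.nodup (fun z => ⟨fun hz => hz.elim, fun hz => (hz (h.cover z)).elim⟩) contiguous_empty
      (hb [] _ rfl) hr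
  obtain ⟨h1, h2⟩ := sweep_eat_prefix hν hpos hno h0
    (fun u₁ u₂ e => by
      simpa using (h0.segments u₁ (u₂ ++ (c :: T₂ ++ M₂ ++ [b] ++ M₁)) (by simp [e])).1)
    (fun u₁ u₂ p q e e' => by
      have := hb u₁ u₂ e
      rw [e'] at this
      exact this.left.contiguous)
  rw [Set.empty_union] at h1 h2
  exact ⟨h1, h2 ▸ wind_sweep_empty hν hpos h0⟩

/-- The middle left path is absorbed from its other end. -/
theorem IsLipsPaths.sweep_midLeft [Nontrivial V] {ν : Fin 3 → Set V → ℝ}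
    (h : IsLipsPaths G a b c T₁ M₁ T₂ M₂ Lo) (hν : ∀ i, IsMonotoneValuation (ν i))
    (hpos : ∀ i, ∀ S : Set V, S.Nonempty → 0 < ν i S) (hno : NoEFOuter G ν) :
    IsSweep G (entries (T₁ ++ a :: Lo) ∪ entries M₁) (c :: T₂ ++ M₂ ++ [b]) ∧
      wind ν (entries (T₁ ++ a :: Lo) ∪ entries M₁) ∅ (c :: T₂ ++ M₂ ++ [b]) ∅ ≠ 0 := by
  obtain ⟨h1, h2⟩ := h.sweep_lower hν hpos hno
  obtain ⟨h3, h4⟩ := sweep_eat_suffix hν hpos hno h1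
    (fun u₁ u₂ e => by
      have r := isChain_reverse_adj (isChain_right (p := b :: u₁)
        (q := u₂ ++ [a]) (by simpa [e] using h.midLeft))
      rw [List.reverse_append] at r
      simpa using h1.contiguous.union_entries (w := u₂.reverse)
        (grows_of_isChain (x := a) (by simp) r))
    (fun u₁ u₂ p q e e' => by
      have r1 := isChain_reverse_adj (isChain_left (p := b :: u₁)
        (q := u₂ ++ [a]) (by simpa [e] using h.midLeft))
      have r2 := isChain_reverse_adj h.midRight
      have r3 := isChain_reverse_adj h.topRight
      simp only [List.reverse_append, List.reverse_cons, List.reverse_nil, List.nil_append,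
        List.cons_append] at r1 r2 r3
      have g1 : Grows G (entries (u₁.reverse ++ [b])) M₂.reverse :=
        grows_of_isChain (x := b) (by simp) (isChain_left (q := [c]) (by simpa using r2))
      have g2 : Grows G (entries (u₁.reverse ++ [b]) ∪ entries M₂.reverse)
          (T₂.reverse ++ [c]) :=
        grows_of_isChain (x := b) (by simp) r3
      have hB := Builds.append (x := b) (by simp) (builds_of_isChain r1)
        (grows_append.2 ⟨g1, g2⟩)
      have e2 : u₁.reverse ++ [b] ++ (M₂.reverse ++ (T₂.reverse ++ [c])) =
          q.reverse ++ p.reverse := by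
        rw [← List.reverse_append, ← e']
        simp
      rw [e2] at hB
      simpa using hB.left.contiguous)
  exact ⟨h3, h4 ▸ h2⟩

/-- The remaining cycle is reordered so that removing its last entry `b` leaves a path in order. -/
theorem IsLipsPaths.sweep_rotated [Nontrivial V] {ν : Fin 3 → Set V → ℝ}
    (h : IsLipsPaths G a b c T₁ M₁ T₂ M₂ Lo) (hν : ∀ i, IsMonotoneValuation (ν i))
    (hpos : ∀ i, ∀ S : Set V, S.Nonempty → 0 < ν i S) (hno : NoEFOuter G ν) :
    IsSweep G (entries (T₁ ++ a :: Lo) ∪ entries M₁) ((c :: T₂).reverse ++ M₂ ++ [b]) ∧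
      wind ν (entries (T₁ ++ a :: Lo) ∪ entries M₁) ∅ ((c :: T₂).reverse ++ M₂ ++ [b]) ∅ ≠ 0 := by
  obtain ⟨h1, h2⟩ := h.sweep_midLeft hν hpos hno
  obtain ⟨h3, h4⟩ := sweep_reverse hν hno (c :: T₂) (M₂ ++ [b]) (by simpa using h1.nodup)
    (by simpa using h1.mem_iff) h1.contiguous
    (fun s m t e => by
      have ht := h.topRight
      rw [e] at ht
      refine ⟨contiguous_of_isChain (isChain_right (isChain_left (isChain_left ht))), ?_⟩
      have r := isChain_reverse_adj (isChain_right (p := s ++ m) (q := t ++ [b])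
        (by simpa using ht))
      rw [List.reverse_append] at r
      -- If `s` is empty, `t` hangs on `b`, the end of `X`. Otherwise `s` contains `c`, which joins
      -- it to `X`, and `t` again hangs on `b`.
      rcases s with _ | ⟨x, s⟩
      · have r2 := isChain_reverse_adj (w := M₂ ++ [b]) (isChain_right (p := [c]) h.midRight)
        rw [List.reverse_append] at r2
        have := (Builds.append (x := b) (by simp) (builds_of_isChain r2)
          (grows_of_isChain (x := b) (by simp) r)).contiguous
        have e1 : entries ([] ++ t ++ (M₂ ++ [b])) =
            entries ([b].reverse ++ M₂.reverse ++ t.reverse) := by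
          ext z; simp; tauto
        rw [e1]
        exact this
      · simp only [List.cons_append, List.cons.injEq] at e
        obtain ⟨rfl, e⟩ := e
        have b1 := builds_of_isChain (isChain_left (isChain_left (isChain_left ht)))
        have := (Builds.append (x := c) (by simp) b1 (grows_append.2
          ⟨grows_of_isChain (x := c) (by simp) h.midRight,
            grows_of_isChain (x := b) (by simp) r⟩)).contiguous
        have e1 : entries (c :: s ++ t ++ (M₂ ++ [b])) =
            entries (c :: s ++ ((M₂ ++ [b]) ++ t.reverse)) := by
          ext z; simp; tauto
        rw [e1]
        exact this)
    (fun p q e => by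
      have hm := h.midRight
      rw [List.cons_append, e, ← List.cons_append] at hm
      exact ⟨(Builds.append (x := c) (by simp) (builds_of_isChain (isChain_left h.topRight))
        (grows_of_isChain (x := c) (by simp) (isChain_left hm))).contiguous,
        contiguous_of_isChain (isChain_right hm)⟩)
  rw [← List.append_assoc] at h3 h4
  rw [← List.append_assoc] at h4
  exact ⟨h3, h4 ▸ h2⟩

theorem IsLipsPaths.guaranteesEFOuter [Nontrivial V]
    (h : IsLipsPaths G a b c T₁ M₁ T₂ M₂ Lo) : GuaranteesEFOuter G 1 3 := by
  refine guaranteesEFOuter_of_pos fun ν hν hpos hno => ?_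
  obtain ⟨h1, h2⟩ := h.sweep_rotated hν hpos hno
  have ch : (b :: (c :: T₂).reverse ++ M₂).IsChain G.Adj := by
    have r := isChain_reverse_adj h.topRight
    have := List.isChain_split (c := c) (l₁ := b :: T₂.reverse) (l₂ := M₂) |>.2
      ⟨by simpa using r, isChain_left h.midRight⟩
    simpa using this
  have ch' : ((c :: T₂).reverse ++ M₂).IsChain G.Adj := isChain_right (p := [b]) ch
  have cb : Contiguous G (entries (T₁ ++ a :: Lo) ∪ entries M₁ ∪ entries [b]) := by
    have r := isChain_reverse_adj h.midLeft
    simp only [List.reverse_append, List.reverse_cons, List.reverse_nil, List.nil_append,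
      List.cons_append] at r
    have hm : a ∈ entries (T₁ ++ a :: Lo) := by simp
    have := (h.sweep_lower hν hpos hno).1.contiguous.union_entries (grows_of_isChain hm r)
    rwa [entries_append M₁.reverse, entries_reverse, ← Set.union_assoc] at this
  obtain ⟨h3, h4⟩ := sweep_eat_suffix hν hpos hno h1
    (fun u₁ u₂ e => by
      rcases u₁ with _ | ⟨x, u₁⟩
      · simp only [List.nil_append] at e
        rw [← e]
        exact cb
      · simp only [List.cons_append, List.cons.injEq] at e
        obtain ⟨rfl, rfl⟩ := List.append_eq_nil_iff.1 e.2.symm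
        simpa using h1.contiguous)
    (fun u₁ u₂ p q e e' => by
      rcases u₁ with _ | ⟨x, u₁⟩
      · rw [List.append_nil] at e'
        exact (contiguous_of_isChain_append ch' e').2
      · simp only [List.cons_append, List.cons.injEq] at e
        obtain ⟨rfl, e⟩ := e
        obtain ⟨rfl, rfl⟩ := List.append_eq_nil_iff.1 e.symm
        exact (h1.segments p q e').2)
  rw [← List.append_nil ((c :: T₂).reverse ++ M₂)] at h3
  obtain ⟨h5, h6⟩ := sweep_eat_prefix hν hpos hno h3
    (fun u₁ u₂ e => by
      have hm : b ∈ entries (T₁ ++ a :: Lo) ∪ entries M₁ ∪ entries [b] := by simp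
      have ch2 := ch
      rw [List.cons_append, e, ← List.cons_append] at ch2
      exact h3.contiguous.union_entries (grows_of_isChain hm (isChain_left ch2)))
    (fun u₁ u₂ p q e e' => by
      rw [e] at ch'
      rw [List.append_nil] at e'
      exact (contiguous_of_isChain_append (isChain_right ch') e').1)
  rw [List.append_nil] at h6
  rw [h4, h6] at h2
  -- Everything has been absorbed, and the empty list has winding zero.
  exact h2 rfl

end LipsSweep

/-! ### From subdivisions to paths -/

section Extraction

theorem isChain_cons_ofFn_append {α : Type*} {R : α → α → Prop} {n : ℕ} (f : Fin n → α) (s t : α)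
    (h : ∀ i : Fin (n + 1), R ((Fin.cons s f : Fin (n + 1) → α) i)
      ((Fin.snoc f t : Fin (n + 1) → α) i)) :
    (s :: List.ofFn f ++ [t]).IsChain R := by
  rw [List.isChain_iff_getElem]
  intro i hi
  have hi' : i < n + 1 := by simpa using hi
  have h1 : (s :: List.ofFn f ++ [t])[i] = (Fin.cons s f : Fin (n + 1) → α) ⟨i, hi'⟩ := by
    rw [List.getElem_append_left (by simpa using hi')]
    cases i with
    | zero => rfl
    | succ j =>
      rw [List.getElem_cons_succ, List.getElem_ofFn]
      rfl
  have h2 : (s :: List.ofFn f ++ [t])[i + 1] = (Fin.snoc f t : Fin (n + 1) → α) ⟨i, hi'⟩ := by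
    simp only [List.cons_append, List.getElem_cons_succ]
    rcases Nat.lt_succ_iff_lt_or_eq.1 hi' with hlt | rfl
    · rw [List.getElem_append_left (by simpa using hlt), List.getElem_ofFn]
      exact (Fin.snoc_castSucc (α := fun _ => α) t f ⟨i, hlt⟩).symm
    · rw [List.getElem_append_right (by simp)]
      simp only [List.length_ofFn, Nat.sub_self, List.getElem_cons_zero]
      exact (Fin.snoc_last (α := fun _ => α) t f).symm
  rw [h1, h2]
  exact h _

variable {α β α' β' : Type*} {G : Graph α β} {H : Graph α' β'}

/-- Two inner vertices differ in position. Two original vertices meet only on an edge that is not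
subdivided, hence the hypothesis on the ends. -/
theorem Subdivision.cons_ne_snoc (D : Subdivision G H) (e : G.edgeSet) (hne : D.s e ≠ D.t e)
    (i : Fin (D.n e + 1)) :
    (Fin.cons (Sum.inl (D.s e)) fun j => Sum.inr ⟨e, j⟩ :
      Fin (D.n e + 1) → G.vertexSet ⊕ (Σ e : G.edgeSet, Fin (D.n e))) i ≠
    (Fin.snoc (fun j => Sum.inr ⟨e, j⟩) (Sum.inl (D.t e)) :
      Fin (D.n e + 1) → G.vertexSet ⊕ (Σ e : G.edgeSet, Fin (D.n e))) i := by
  obtain ⟨i, hi⟩ := i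
  cases i with
  | zero =>
    simp only [Fin.snoc]
    split_ifs
    · exact Sum.inl_ne_inr
    · exact fun h => hne (Sum.inl_injective h)
  | succ i =>
    simp only [Fin.snoc]
    split_ifs
    · intro h
      have := congrArg (fun x : Fin (D.n e) => (x : ℕ))
        (eq_of_heq (Sigma.mk.inj (Sum.inr_injective h)).2)
      simp at this
    · exact Sum.inr_ne_inl

/-- The subdivided edge `e` is a path. -/
theorem Subdivision.isChain (D : Subdivision G H) (e : G.edgeSet) (hne : D.s e ≠ D.t e) :
    ((Sum.inl (D.s e) :: List.ofFn (fun j => Sum.inr ⟨e, j⟩) ++ [Sum.inl (D.t e)] :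
      List (G.vertexSet ⊕ (Σ e : G.edgeSet, Fin (D.n e)))).map D.vertexEquiv).IsChain
      H.toSimpleGraph.Adj := by
  rw [List.isChain_map]
  exact isChain_cons_ofFn_append _ _ _ fun i =>
    ⟨D.vertexEquiv.injective.ne (D.cons_ne_snoc e hne i), _, D.isLink e i⟩

/-- The subdivided edge `e` is a path between its ends, in any orientation. -/
theorem Subdivision.exists_path (D : Subdivision G H) (e : G.edgeSet) (x y : G.vertexSet)
    (hxy : x ≠ y) (h : G.IsLink e x y) :
    ∃ l : List (G.vertexSet ⊕ (Σ e : G.edgeSet, Fin (D.n e))), l.Nodup ∧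
      (∀ z, z ∈ l ↔ ∃ j, z = Sum.inr ⟨e, j⟩) ∧
      (D.vertexEquiv (Sum.inl x) :: l.map D.vertexEquiv ++ [D.vertexEquiv (Sum.inl y)]).IsChain
        H.toSimpleGraph.Adj := by
  let l : List (G.vertexSet ⊕ (Σ e : G.edgeSet, Fin (D.n e))) :=
    List.ofFn fun j => Sum.inr ⟨e, j⟩
  have hn : l.Nodup := by
    rw [List.nodup_ofFn]
    intro i j hij
    exact eq_of_heq (Sigma.mk.inj (Sum.inr_injective hij)).2
  have hm : ∀ z, z ∈ l ↔ ∃ j, z = Sum.inr ⟨e, j⟩ := by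
    intro z
    simp [l, List.mem_ofFn, eq_comm]
  rcases h.eq_and_eq_or_eq_and_eq (D.isLink_ends e) with ⟨hx, hy⟩ | ⟨hx, hy⟩
  · obtain rfl := Subtype.ext hx
    obtain rfl := Subtype.ext hy
    exact ⟨l, hn, hm, by simpa [l] using D.isChain e hxy⟩
  · obtain rfl := Subtype.ext hx
    obtain rfl := Subtype.ext hy
    refine ⟨l.reverse, List.nodup_reverse.2 hn, by simpa using hm, ?_⟩
    have := isChain_reverse_adj (D.isChain e hxy.symm)
    simpa [l] using this

theorem Subdivision.isLipsPaths (D : Subdivision lips H) :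
    ∃ a b c T₁ M₁ T₂ M₂ Lo, IsLipsPaths H.toSimpleGraph a b c T₁ M₁ T₂ M₂ Lo := by
  let a : lips.vertexSet := ⟨.a, trivial⟩
  let b : lips.vertexSet := ⟨.b, trivial⟩
  let c : lips.vertexSet := ⟨.c, trivial⟩
  have hab : a ≠ b := fun h => nomatch congrArg Subtype.val h
  have hac : a ≠ c := fun h => nomatch congrArg Subtype.val h
  have hbc : b ≠ c := fun h => nomatch congrArg Subtype.val h
  obtain ⟨l₁, n₁, m₁, c₁⟩ := D.exists_path ⟨.topLeft, trivial⟩ b a hab.symm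
    (Sym2.eq_swap : s(LipsVertex.a, LipsVertex.b) = s(.b, .a))
  obtain ⟨l₂, n₂, m₂, c₂⟩ := D.exists_path ⟨.midLeft, trivial⟩ b a hab.symm
    (Sym2.eq_swap : s(LipsVertex.a, LipsVertex.b) = s(.b, .a))
  obtain ⟨l₃, n₃, m₃, c₃⟩ := D.exists_path ⟨.topRight, trivial⟩ c b hbc.symm
    (Sym2.eq_swap : s(LipsVertex.b, LipsVertex.c) = s(.c, .b))
  obtain ⟨l₄, n₄, m₄, c₄⟩ := D.exists_path ⟨.midRight, trivial⟩ c b hbc.symm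
    (Sym2.eq_swap : s(LipsVertex.b, LipsVertex.c) = s(.c, .b))
  obtain ⟨l₅, n₅, m₅, c₅⟩ := D.exists_path ⟨.lower, trivial⟩ a c hac
    (rfl : s(LipsVertex.a, LipsVertex.c) = s(.a, .c))
  let w := l₁ ++ Sum.inl a :: l₅ ++ (Sum.inl c :: l₃ ++ l₄ ++ [Sum.inl b] ++ l₂)
  have hw : w.map D.vertexEquiv = l₁.map D.vertexEquiv ++ D.vertexEquiv (Sum.inl a) ::
      l₅.map D.vertexEquiv ++ (D.vertexEquiv (Sum.inl c) :: l₃.map D.vertexEquiv ++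
      l₄.map D.vertexEquiv ++ [D.vertexEquiv (Sum.inl b)] ++ l₂.map D.vertexEquiv) := by
    simp [w]
  refine ⟨_, _, _, _, _, _, _, _, c₁, c₂, c₃, c₄, c₅, ?_, ?_⟩
  · rw [← hw]
    refine List.Nodup.map D.vertexEquiv.injective ?_
    simp only [w, List.nodup_append, List.nodup_cons, List.mem_append, List.mem_cons, m₁, m₂, m₃,
      m₄, m₅, n₁, n₂, n₃, n₄, n₅]
    simp [a, b, c]
    grind
  · intro z
    rw [← hw, List.mem_map]
    refine ⟨D.vertexEquiv.symm z, ?_, by simp⟩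
    generalize D.vertexEquiv.symm z = y
    rcases y with ⟨y, hy⟩ | ⟨⟨e, he⟩, j⟩
    · cases y <;> simp [w, a, b, c]
    · cases e <;> simp [w, m₁, m₂, m₃, m₄, m₅]

theorem guaranteesEFOuter_of_subdivision (D : Subdivision lips H) :
    GuaranteesEFOuter H.toSimpleGraph 1 3 := by
  have : Nontrivial lips.vertexSet := 
    ⟨⟨.a, trivial⟩, ⟨.b, trivial⟩, fun h => nomatch congrArg Subtype.val h⟩
  have : Nontrivial H.vertexSet :=
    (D.vertexEquiv.injective.comp Sum.inl_injective).nontrivial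
  obtain ⟨a, b, c, T₁, M₁, T₂, M₂, Lo, h⟩ := D.isLipsPaths
  exact h.guaranteesEFOuter

end Extraction

/-! ### Subdivisions of simple graphs -/

section Simple

variable {α β α' β' : Type*} {G : Graph α β} {H : Graph α' β'}

/-- The vertices of a subdivision, with a subdivision vertex given by its edge and position. -/
def Subdivision.code (D : Subdivision G H) :
    G.vertexSet ⊕ (Σ e : G.edgeSet, Fin (D.n e)) → G.vertexSet ⊕ (G.edgeSet × ℕ) :=
  Sum.map id fun p => (p.1, p.2)

theorem Subdivision.code_cons (D : Subdivision G H) (e : G.edgeSet) (i : Fin (D.n e + 1)) :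
    D.code ((Fin.cons (Sum.inl (D.s e)) fun j => Sum.inr ⟨e, j⟩ :
      Fin (D.n e + 1) → G.vertexSet ⊕ (Σ e : G.edgeSet, Fin (D.n e))) i) =
    if (i : ℕ) = 0 then Sum.inl (D.s e) else Sum.inr (e, (i : ℕ) - 1) := by
  refine Fin.cases ?_ (fun j => ?_) i
  · simp [Subdivision.code]
  · simp [Subdivision.code]

theorem Subdivision.code_snoc (D : Subdivision G H) (e : G.edgeSet) (i : Fin (D.n e + 1)) :
    D.code ((Fin.snoc (fun j => Sum.inr ⟨e, j⟩) (Sum.inl (D.t e)) :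
      Fin (D.n e + 1) → G.vertexSet ⊕ (Σ e : G.edgeSet, Fin (D.n e))) i) =
    if (i : ℕ) = D.n e then Sum.inl (D.t e) else Sum.inr (e, (i : ℕ)) := by
  refine Fin.lastCases ?_ (fun j => ?_) i
  · simp [Subdivision.code]
  · simp [Subdivision.code, j.2.ne]

theorem Subdivision.ends_ne (D : Subdivision G H) [G.Loopless] (e : G.edgeSet) :
    D.s e ≠ D.t e := by
  intro h
  have := D.isLink_ends e
  rw [← h] at this
  exact G.not_isLoopAt e (D.s e) this

/-- The two ends of an edge of a subdivision. -/
theorem Subdivision.isLink_iff (D : Subdivision G H) {f : β'} {x y : α'} (h : H.IsLink f x y) :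
    ∃ (e : G.edgeSet) (i : Fin (D.n e + 1)) (p q : G.vertexSet ⊕ (Σ e : G.edgeSet, Fin (D.n e))),
      f = D.edgeEquiv ⟨e, i⟩ ∧
      D.code p = (if (i : ℕ) = 0 then Sum.inl (D.s e) else Sum.inr (e, (i : ℕ) - 1)) ∧
      D.code q = (if (i : ℕ) = D.n e then Sum.inl (D.t e) else Sum.inr (e, (i : ℕ))) ∧
      ((x = D.vertexEquiv p ∧ y = D.vertexEquiv q) ∨
        (x = D.vertexEquiv q ∧ y = D.vertexEquiv p)) := by
  obtain ⟨⟨e, i⟩, hi⟩ := D.edgeEquiv.surjective ⟨f, h.edge_mem⟩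
  have hf : f = D.edgeEquiv ⟨e, i⟩ := by rw [hi]
  subst hf
  exact ⟨e, i, _, _, rfl, D.code_cons e i, D.code_snoc e i,
    h.eq_and_eq_or_eq_and_eq (D.isLink e i)⟩

/-- An inner end reveals the original edge and leaves at most two positions along it; if both ends
are original, the edge is not subdivided and simplicity of `G` applies. -/
theorem Subdivision.simple (D : Subdivision G H) [G.Simple] : H.Simple where
  not_isLoopAt f x h := by
    obtain ⟨e, i, p, q, -, hp, hq, hx⟩ := D.isLink_iff h
    have hpq : p = q := by
      rcases hx with ⟨h1, h2⟩ | ⟨h1, h2⟩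
      · exact D.vertexEquiv.injective (Subtype.ext (h1.symm.trans h2))
      · exact D.vertexEquiv.injective (Subtype.ext (h2.symm.trans h1))
    have hne := D.ends_ne e
    rw [hpq, hq] at hp
    split_ifs at hp
    · exact hne (Sum.inl_injective hp).symm
    · have := (Prod.mk.inj (Sum.inr_injective hp)).2
      omega
  eq_of_isLink f f' x y h h' := by
    obtain ⟨e, i, p, q, rfl, hp, hq, hx⟩ := D.isLink_iff h
    obtain ⟨e', i', p', q', rfl, hp', hq', hx'⟩ := D.isLink_iff h'
    have hne := D.ends_ne e
    have hv : ∀ p q : G.vertexSet ⊕ (Σ e : G.edgeSet, Fin (D.n e)),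
        (D.vertexEquiv p : α') = D.vertexEquiv q → p = q := fun p q h =>
      D.vertexEquiv.injective (Subtype.ext h)
    have hee : D.s e = D.s e' → D.t e = D.t e' → e = e' := by
      intro hs ht
      have h1 := D.isLink_ends e
      rw [hs, ht] at h1
      exact Subtype.ext (h1.eq (D.isLink_ends e'))
    have hee' : D.s e = D.t e' → D.t e = D.s e' → e = e' := by
      intro hs ht
      have h1 := D.isLink_ends e
      rw [hs, ht] at h1
      exact Subtype.ext (h1.eq (D.isLink_ends e').symm)
    have key : e = e' ∧ (i : ℕ) = i' := by
      have hpq : (p = p' ∧ q = q') ∨ (p = q' ∧ q = p') := by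
        rcases hx with ⟨h1, h2⟩ | ⟨h1, h2⟩ <;> rcases hx' with ⟨h3, h4⟩ | ⟨h3, h4⟩
        · exact Or.inl ⟨hv _ _ (h1.symm.trans h3), hv _ _ (h2.symm.trans h4)⟩
        · exact Or.inr ⟨hv _ _ (h1.symm.trans h3), hv _ _ (h2.symm.trans h4)⟩
        · exact Or.inr ⟨hv _ _ (h2.symm.trans h4), hv _ _ (h1.symm.trans h3)⟩
        · exact Or.inl ⟨hv _ _ (h2.symm.trans h4), hv _ _ (h1.symm.trans h3)⟩
      rcases hpq with ⟨rfl, rfl⟩ | ⟨rfl, rfl⟩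
      · rw [hp] at hp'
        rw [hq] at hq'
        split_ifs at hp' hq' <;> grind
      -- In opposite directions, a common inner end would require a loop with one inner vertex,
      -- which `hne` excludes.
      · rw [hp] at hq'
        rw [hq] at hp'
        split_ifs at hp' hq' <;> grind
    obtain ⟨rfl, hi⟩ := key
    rw [Fin.ext hi]

end Simple

/-! ### Counting components by colours -/

section Colours

/-- The number of colours of a list is at most one more than the number of separators, when the
colour changes only at separators. -/
theorem card_colours_le {C : Type*} [DecidableEq C] (m : List (Option C))
    (h : m.IsChain fun x y => x = none ∨ y = none ∨ x = y) :
    (m.reduceOption.toFinset).card ≤ m.count none + 1 ∧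
      ∀ m', m = none :: m' → (m.reduceOption.toFinset).card ≤ m.count none := by
  induction m with
  | nil => simp
  | cons x m ih =>
    have hm := ih h.tail
    rcases x with _ | k
    · simp only [List.reduceOption_cons_of_none, List.count_cons_self]
      exact ⟨by omega, fun _ _ => hm.1⟩
    · refine ⟨?_, fun m' e => by simp at e⟩
      rw [List.reduceOption_cons_of_some, List.toFinset_cons,
        List.count_cons_of_ne (by simp)]
      rcases m with _ | ⟨_ | k', m⟩
      · simp
      -- The tail starts with a separator, so its sharper bound leaves room for the new colour.
      · exact (Finset.card_insert_le _ _).trans (Nat.succ_le_succ (hm.2 m rfl))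
      · have hk : k = k' := by
          have := (List.isChain_cons_cons.1 h).1
          simpa using this
        rw [Finset.insert_eq_of_mem (by simp [hk, List.reduceOption_cons_of_some])]
        exact hm.1

variable {α β α' β' : Type*} {G : Graph α β} {H : Graph α' β'} {C : Type*}

/-- The colouring of a subdivision by the colours of the vertices and edges of a graph. -/
def Subdivision.colour (D : Subdivision G H) (col : α → Option C) (cls : β → C)
    (z : H.vertexSet) : Option C :=
  Sum.elim (fun v => col v.1) (fun p => some (cls p.1.1)) (D.vertexEquiv.symm z)

/-- Both ends of a piece of `e` are either separators or of the colour of `e`. -/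
theorem Subdivision.colour_adj (D : Subdivision G H) {col : α → Option C} {cls : β → C}
    (h : ∀ e x y, G.IsLink e x y → col x = none ∨ col x = some (cls e)) {u v : H.vertexSet}
    (huv : H.toSimpleGraph.Adj u v) :
    D.colour col cls u = none ∨ D.colour col cls v = none ∨
      D.colour col cls u = D.colour col cls v := by
  obtain ⟨-, f, hf⟩ := huv
  obtain ⟨e, i, p, q, -, hp, hq, hx⟩ := D.isLink_iff hf
  have hs := h e _ _ (D.isLink_ends e)
  have ht := h e _ _ (D.isLink_ends e).symm
  have hcol : ∀ p, D.colour col cls (D.vertexEquiv p) =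
      Sum.elim (fun v => col v.1) (fun p => some (cls p.1.1)) (D.code p) := by
    intro p
    rcases p with p | p <;> simp [Subdivision.colour, Subdivision.code]
  have hcp : D.colour col cls (D.vertexEquiv p) = none ∨
      D.colour col cls (D.vertexEquiv p) = some (cls e) := by
    rw [hcol, hp]
    split_ifs
    · simpa using hs
    · simp
  have hcq : D.colour col cls (D.vertexEquiv q) = none ∨
      D.colour col cls (D.vertexEquiv q) = some (cls e) := by
    rw [hcol, hq]
    split_ifs
    · simpa using ht
    · simp
  rcases hx with ⟨hu, hv⟩ | ⟨hu, hv⟩ <;> rw [Subtype.ext hu, Subtype.ext hv] <;> grind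

/-- A graph with a Hamiltonian path has at most one more colour than separators. -/
theorem card_colours_le_of_hasHamiltonianPath {V : Type*} {G : SimpleGraph V}
    (h : HasHamiltonianPath G) (col : V → Option C)
    (hadj : ∀ u v, G.Adj u v → col u = none ∨ col v = none ∨ col u = col v) (S : List V)
    (hS : ∀ z, col z = none → z ∈ S) (K : Finset C) (hK : ∀ k ∈ K, ∃ z, col z = some k) :
    K.card ≤ S.length + 1 := by
  classical
  obtain ⟨u, v, p, hp⟩ := h
  have hmem : ∀ z, z ∈ p.support := fun z => hp.mem_support z
  have hnodup : p.support.Nodup := hp.isPath.support_nodup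
  have hchain : (p.support.map col).IsChain fun x y => x = none ∨ y = none ∨ x = y := by
    rw [List.isChain_map]
    exact p.isChain_adj_support.imp fun _ _ => hadj _ _
  have h1 := (card_colours_le _ hchain).1
  have h2 : (p.support.map col).count none ≤ S.length := by
    rw [List.count_eq_countP, List.countP_map, List.countP_eq_length_filter]
    refine ((hnodup.filter _).subperm fun z hz => hS z ?_).length_le
    simpa using (List.mem_filter.1 hz).2
  refine (Finset.card_le_card fun k hk => ?_).trans (h1.trans (Nat.succ_le_succ h2))
  obtain ⟨z, hz⟩ := hK k hk
  rw [List.mem_toFinset, List.reduceOption_mem_iff]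
  exact List.mem_map.2 ⟨z, hmem z, hz⟩

end Colours

/-! ### The bisected lips -/

section SubdividedLips

/-- The first end of an edge of the lips. -/
def lipsFst : LipsEdge → LipsVertex
  | .topLeft => .a
  | .midLeft => .a
  | .topRight => .b
  | .midRight => .b
  | .lower => .a

/-- The second end of an edge of the lips. -/
def lipsSnd : LipsEdge → LipsVertex
  | .topLeft => .b
  | .midLeft => .b
  | .topRight => .c
  | .midRight => .c
  | .lower => .c

theorem lipsEnds_eq (e : LipsEdge) : lipsEnds e = s(lipsFst e, lipsSnd e) := by
  cases e <;> rfl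

theorem lipsFst_ne_lipsSnd (e : LipsEdge) : lipsFst e ≠ lipsSnd e := by
  cases e <;> simp [lipsFst, lipsSnd]

/-- The multigraph in which every edge has the given ends. -/
def Graph.ofEnds {α β : Type*} (ends : β → Sym2 α) : Graph α β where
  vertexSet := Set.univ
  edgeSet := Set.univ
  IsLink e x y := ends e = s(x, y)
  isLink_symm := fun _ _ => ⟨fun _ _ h => h.trans Sym2.eq_swap⟩
  eq_or_eq_of_isLink_of_isLink := by
    intro e x y v w h h'
    have := h.symm.trans h'
    rw [Sym2.eq_iff] at this
    tauto
  edge_mem_iff_exists_isLink := by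
    intro e
    refine ⟨fun _ => ?_, fun _ => Set.mem_univ _⟩
    induction h : ends e with
    | _ x y => exact ⟨x, y, rfl⟩
  left_mem_of_isLink := fun _ _ _ _ => Set.mem_univ _

/-- The ends of the two halves of the edges of the lips. -/
def halfEnds : ULift.{u} (LipsEdge × Bool) → Sym2 (ULift.{u} (LipsVertex ⊕ LipsEdge))
  | ⟨e, false⟩ => s(⟨Sum.inl (lipsFst e)⟩, ⟨Sum.inr e⟩)
  | ⟨e, true⟩ => s(⟨Sum.inr e⟩, ⟨Sum.inl (lipsSnd e)⟩)

/-- The lips with one new vertex on each edge. -/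
def halvedLips : Graph (ULift.{u} (LipsVertex ⊕ LipsEdge)) (ULift.{u} (LipsEdge × Bool)) :=
  Graph.ofEnds halfEnds

/-- The halved lips as a subdivision of the lips. -/
def halvedLipsSubdivision : Subdivision lips halvedLips.{u} where
  s e := ⟨lipsFst e, trivial⟩
  t e := ⟨lipsSnd e, trivial⟩
  isLink_ends e := lipsEnds_eq e
  n _ := 1
  vertexEquiv :=
    { toFun := Sum.elim (fun v => ⟨⟨Sum.inl v⟩, trivial⟩) (fun p => ⟨⟨Sum.inr p.1⟩, trivial⟩)
      invFun := fun z => Sum.elim (fun v => Sum.inl ⟨v, trivial⟩)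
        (fun e => Sum.inr ⟨⟨e, trivial⟩, 0⟩) z.1.down
      left_inv := by
        rintro (⟨v, _⟩ | ⟨⟨e, _⟩, i⟩)
        · rfl
        · rw [Subsingleton.elim i 0]
          rfl
      right_inv := by
        rintro ⟨⟨v | e⟩, _⟩ <;> rfl }
  edgeEquiv :=
    { toFun := fun p => ⟨⟨p.1, decide (p.2 = 1)⟩, trivial⟩
      invFun := fun f => ⟨⟨f.1.down.1, trivial⟩, if f.1.down.2 then 1 else 0⟩
      left_inv := by
        rintro ⟨⟨e, _⟩, i⟩
        fin_cases i <;> rfl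
      right_inv := by
        rintro ⟨⟨e, i⟩, _⟩
        cases i <;> rfl }
  isLink e i := by
    fin_cases i <;> rfl

theorem halfEnds_injective : Function.Injective halfEnds.{u} := by
  rintro ⟨e, _ | _⟩ ⟨f, _ | _⟩ h <;> simp [halfEnds] at h ⊢
  · exact h.2
  · exact lipsFst_ne_lipsSnd e (by rw [h.1, h.2])
  · exact lipsFst_ne_lipsSnd e (by rw [h.2, h.1])
  · exact h.1

theorem halvedLips_simple : halvedLips.{u}.Simple where
  not_isLoopAt f x h := by
    have h' : halfEnds f = s(x, x) := h
    rcases f with ⟨e, _ | _⟩ <;> simp [halfEnds] at h' <;> simp [← h'.1] at h'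
  eq_of_isLink f f' x y h h' :=
    halfEnds_injective (Eq.trans (b := s(x, y)) h (Eq.symm h'))

/-- The colours are the five edges of the lips, inherited by all vertices inserted along them; the
separators are `a`, `b`, `c`. Each colour occurs, thanks to the midpoints. -/
theorem not_hasHamiltonianPath_of_subdivision {α β : Type*} {K : Graph α β}
    (D : Subdivision halvedLips.{u} K) : ¬ HasHamiltonianPath K.toSimpleGraph := by
  classical
  intro h
  let col : ULift.{u} (LipsVertex ⊕ LipsEdge) → Option LipsEdge :=
    fun z => Sum.elim (fun _ => none) some z.down
  let cls : ULift.{u} (LipsEdge × Bool) → LipsEdge := fun f => f.down.1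
  have hlink : ∀ e x y, halvedLips.{u}.IsLink e x y →
      col x = none ∨ col x = some (cls e) := by
    intro f x y hf
    have hf : halfEnds f = s(x, y) := hf
    rcases f with ⟨e, _ | _⟩ <;> simp only [halfEnds, Sym2.eq_iff] at hf <;>
      rcases hf with ⟨rfl, rfl⟩ | ⟨rfl, rfl⟩ <;> simp [col, cls]
  let vert : LipsVertex → K.vertexSet := fun v =>
    D.vertexEquiv (Sum.inl ⟨⟨Sum.inl v⟩, trivial⟩)
  have := card_colours_le_of_hasHamiltonianPath h (D.colour col cls)
    (fun u v huv => D.colour_adj hlink huv) [vert .a, vert .b, vert .c]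
    (fun z hz => by
      obtain ⟨p, rfl⟩ := D.vertexEquiv.surjective z
      rcases p with ⟨⟨v | e⟩, _⟩ | p
      · cases v <;> simp [vert]
      · simp [Subdivision.colour, col] at hz
      · simp [Subdivision.colour] at hz)
    {.topLeft, .midLeft, .topRight, .midRight, .lower}
    (fun k _ => ⟨D.vertexEquiv (Sum.inl ⟨⟨Sum.inr k⟩, trivial⟩), by
      simp [Subdivision.colour, col]⟩)
  -- Five colours would have to be at most three separators plus one.
  simp at this

end SubdividedLips

theorem mainTheorem4 :
    (∀ G ∈ topologicalClass.{u} lips, GuaranteesEFOuter G.graph.toSimpleGraph 1 3) ∧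
    EventuallyAll.{u} lips
      (fun G => G.graph.Simple ∧ ¬ HasHamiltonianPath G.graph.toSimpleGraph) := by
  refine ⟨fun G ⟨D⟩ => guaranteesEFOuter_of_subdivision D,
    ⟨_, _, halvedLips⟩, ⟨halvedLipsSubdivision⟩, fun K ⟨_, ⟨D⟩⟩ => ⟨?_, ?_⟩⟩
  · have := halvedLips_simple.{u}
    exact D.simple
  · exact not_hasHamiltonianPath_of_subdivision D
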